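/- Let $\Bbbk$ be a commutative ring, $A$ an associative unital $\Bbbk$-algebra and $\Omega^\bullet_d=\bigoplus_{n\ge 0}\Omega^n_d$ an exterior algebra over $A$, i.e. a differential graded $\Bbbk$-algebra with $\Omega^0_d=A$ that is generated as an algebra by $A$ and $dA$. For a left $A$-module $E$ put $J^1_dE=J^1_dA\otimes_A E$, where $J^1_dA=(A\otimes_{\Bbbk} A)/\{\sum_i a_i\otimes b_i : \sum_i a_ib_i=0,\ \sum_i a_i\,db_i=0\}$, and define: * the symmetric forms $S^0_dE=E$, $S^1_dE=\Omega^1_d\otimes_AE$ and, for $n\ge 2$, $S^n_dE=\ker\big(\Omega^1_d\otimes_A S^{n-1}_dE\to\Omega^1_d\otimes_A\Omega^1_d\otimes_A S^{n-2}_dE\xrightarrow{\wedge}\Omega^2_d\otimes_AS^{n-2}_dE\big)$; the Spencer $\delta$-operators $\delta^{n,m}:\Omega^m_d\otimes_AS^n_dE\to\Omega^{m+1}_d\otimes_AS^{n-1}_dE$, $\omega\otimes\sum_j\alpha_j\otimes s_j\mapsto(-1)^m\sum_j(\omega\wedge\alpha_j)\otimes s_j$ for $n\ge1$; and the Spencer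 $\delta$-cohomology $H^{n,m}_{\delta_d}(E)$, the cohomology at $\Omega^m_d\otimes_AS^n_dE$ of the complex $0\to S^{n+m}_dE\to\Omega^1_d\otimes_AS^{n+m-1}_dE\to\cdots\to\Omega^{n+m}_d\otimes_AE\to0$; * the holonomic jets $J^0_dE=E$, $J^1_dE$ and, for $n\ge2$, $J^n_dE\subseteq J^1_dJ^{n-1}_dE$, the submodule of the elements whose image in $J^1_dJ^1_dJ^{n-2}_dE$ is killed by both maps $[a\otimes b]\otimes[c\otimes f]\otimes e\mapsto a\,d(bc)f\otimes e\in\Omega^1_d\otimes_A J^{n-2}_dE$ and $[a\otimes b]\otimes[c\otimes f]\otimes e\mapsto da\wedge d(bc)f\otimes e\in\Omega^2_d\otimes_A J^{n-2}_dE$; the prolongations $j^n_d:E\to J^n_dE$ given by $j^0_d=\mathrm{id}$ and $j^n_d(e)=[1\otimes1]\otimes j^{n-1}_d(e)$; and the Spencer operators $\mathcal S^{n,m}_d:\Omega^m_d\otimes_AJ^n_dE\to\Omega^{m+1}_d\otimes_AJ^{n-1}_dE$, $\omega\otimes\sum_j[y_j\otimes z_j]\otimes\xi_j\mapsto\sum_jd(\omega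 y_j)z_j\otimes\xi_j$ for $n\ge1$. The Spencer complex of order $N\ge0$ at $E$ is $$0\to E\xrightarrow{j^N_d}J^N_dE\xrightarrow{\mathcal S^{N,0}_d}\Omega^1_d\otimes_AJ^{N-1}_dE\xrightarrow{\mathcal S^{N-1,1}_d}\cdots\xrightarrow{\mathcal S^{1,N-1}_d}\Omega^N_d\otimes_AE\to0,$$ and $H^{n,m}_{\mathcal S_d}(E)$ denotes its cohomology at $\Omega^m_d\otimes_AJ^n_dE$ (with $N=n+m$). **Corollary 3.31.** Suppose that every $\Omega^m_d$, $m\ge 0$, is flat as a right $A$-module and that $H^{n,m}_{\delta_d}(E)=0$ for all left $A$-modules $E$ and all $n,m\ge0$ with $(n,m)\ne(0,0)$. Then the Spencer complex is exact: for every left $A$-module $E$, $H^{n,m}_{\mathcal S_d}(E)=0$ for all $n,m\ge0$, and every $j^n_d:E\to J^n_dE$ is injective. -/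

import Mathlib

open scoped TensorProduct
open MulOpposite

noncomputable section

universe u v

namespace NCJet

section Balanced

variable (A : Type u) [Ring A]
variable (M : Type u) [AddCommGroup M] [Module Aᵐᵒᵖ M]
variable (E : Type u) [AddCommGroup E] [Module A E]

/-- The relations `m a ⊗ e = m ⊗ a e` that cut the tensor product over `A` out of the tensor
product of abelian groups. -/
def balancedRel : AddSubgroup (M ⊗[ℤ] E) :=
  AddSubgroup.closure {x | ∃ (m : M) (a : A) (e : E),
    x = (op a • m) ⊗ₜ[ℤ] e - m ⊗ₜ[ℤ] (a • e)}

/-- The tensor product `M ⊗_A E` of a right module and a left module over a (not necessarily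
commutative) ring `A`. -/
def BT : Type u := (M ⊗[ℤ] E) ⧸ balancedRel A M E

instance : AddCommGroup (BT A M E) :=
  inferInstanceAs (AddCommGroup ((M ⊗[ℤ] E) ⧸ balancedRel A M E))

variable {M E}

/-- The class of the pure tensor `m ⊗ e` in `M ⊗_A E`. -/
def BT.tmul (m : M) (e : E) : BT A M E :=
  QuotientAddGroup.mk' (balancedRel A M E) (m ⊗ₜ[ℤ] e)

theorem BT.tmul_add (m : M) (e f : E) :
    BT.tmul A m (e + f) = BT.tmul A m e + BT.tmul A m f := by
  simp only [BT.tmul, TensorProduct.tmul_add]; exact map_add _ _ _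

theorem BT.add_tmul (m n : M) (e : E) :
    BT.tmul A (m + n) e = BT.tmul A m e + BT.tmul A n e := by
  simp only [BT.tmul, TensorProduct.add_tmul]; exact map_add _ _ _

theorem BT.tmul_zero (m : M) : BT.tmul A m (0 : E) = 0 := by
  simp only [BT.tmul, TensorProduct.tmul_zero]; exact map_zero _

theorem BT.zero_tmul (e : E) : BT.tmul A (0 : M) e = 0 := by
  simp only [BT.tmul, TensorProduct.zero_tmul]; exact map_zero _

theorem BT.smul_tmul (m : M) (a : A) (e : E) :
    BT.tmul A (op a • m) e = BT.tmul A m (a • e) := by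
  exact (QuotientAddGroup.eq_iff_sub_mem (N := balancedRel A M E)).2 <|
    AddSubgroup.subset_closure ⟨m, a, e, rfl⟩

variable {A} in
@[elab_as_elim]
theorem BT.induction {P : BT A M E → Prop} (x : BT A M E) (h0 : P 0)
    (ht : ∀ m e, P (BT.tmul A m e)) (ha : ∀ x y, P x → P y → P (x + y)) : P x := by
  obtain ⟨t, rfl⟩ := QuotientAddGroup.mk'_surjective (balancedRel A M E) x
  induction t using TensorProduct.induction_on with
  | zero => rw [map_zero]; exact h0
  | tmul m e => exact ht m e
  | add x y hx hy => rw [map_add]; exact ha _ _ hx hy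

variable {G : Type*} [AddCommGroup G]

variable {A} in
/-- The universal property of `M ⊗_A E`: a balanced biadditive map factors through it. -/
def BT.lift (f : M → E → G) (hl : ∀ m n e, f (m + n) e = f m e + f n e)
    (hr : ∀ m e e', f m (e + e') = f m e + f m e')
    (hb : ∀ m (a : A) e, f (op a • m) e = f m (a • e)) : BT A M E →+ G :=
  QuotientAddGroup.lift (balancedRel A M E)
    (TensorProduct.liftAddHom
      (AddMonoidHom.mk' (fun m => AddMonoidHom.mk' (f m) (hr m))
        (fun m n => AddMonoidHom.ext fun e => hl m n e))
      (fun z m e => by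
        rw [map_zsmul, map_zsmul]; rfl))
    (by
      rw [balancedRel, AddSubgroup.closure_le]
      rintro _ ⟨m, a, e, rfl⟩
      simp only [SetLike.mem_coe, AddMonoidHom.mem_ker, map_sub,
        TensorProduct.liftAddHom_tmul, AddMonoidHom.mk'_apply, sub_eq_zero]
      exact hb m a e)

@[simp] theorem BT.lift_tmul (f : M → E → G) (hl hr) (hb : ∀ m (a : A) e, f (op a • m) e = f m (a • e))
    (m : M) (e : E) : BT.lift f hl hr hb (BT.tmul A m e) = f m e := rfl

variable {F : Type u} [AddCommGroup F] [Module A F]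

variable {A} (M) in
/-- The additive map `id_M ⊗_A f` induced by an `A`-linear map `f`. -/
def BT.map (f : E →ₗ[A] F) : BT A M E →+ BT A M F :=
  BT.lift (fun m e => BT.tmul A m (f e)) (fun _ _ _ => BT.add_tmul A _ _ _)
    (fun _ _ _ => by rw [map_add, BT.tmul_add]) (fun m a e => by rw [BT.smul_tmul, map_smul])

@[simp] theorem BT.map_tmul (f : E →ₗ[A] F) (m : M) (e : E) :
    BT.map M f (BT.tmul A m e) = BT.tmul A m (f e) := rfl

section LeftModule

variable [Module A M] [SMulCommClass A Aᵐᵒᵖ M]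

/-- Left multiplication by `a` on `M ⊗_A E`, for a bimodule `M`. -/
def BT.smulHom (a : A) : BT A M E →+ BT A M E :=
  BT.lift (fun m e => BT.tmul A (a • m) e) (fun _ _ _ => by rw [smul_add, BT.add_tmul])
    (fun _ _ _ => BT.tmul_add A _ _ _)
    (fun m b e => by rw [smul_comm a (op b) m, BT.smul_tmul])

instance : SMul A (BT A M E) := ⟨fun a x => BT.smulHom A a x⟩

theorem BT.smul_def (a : A) (m : M) (e : E) :
    a • BT.tmul A m e = BT.tmul A (a • m) e := rfl

/-- For a bimodule `M`, `M ⊗_A E` is a left `A`-module through `a (m ⊗ e) = (a m) ⊗ e`. -/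
instance : Module A (BT A M E) where
  smul_zero a := map_zero (BT.smulHom A a)
  smul_add a := map_add (BT.smulHom A a)
  one_smul x := by
    induction x using BT.induction with
    | h0 => exact map_zero (BT.smulHom A 1)
    | ht m e => rw [BT.smul_def, one_smul]
    | ha x y hx hy => exact (map_add (BT.smulHom A 1) x y).trans (congrArg₂ _ hx hy)
  mul_smul a b x := by
    change BT.smulHom A (a * b) x = BT.smulHom A a (BT.smulHom A b x)
    induction x using BT.induction with
    | h0 => simp only [map_zero]
    | ht m e =>
      change BT.tmul A ((a * b) • m) e = BT.tmul A (a • b • m) e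
      rw [mul_smul]
    | ha x y hx hy => simp only [map_add, hx, hy]
  add_smul a b x := by
    change BT.smulHom A (a + b) x = BT.smulHom A a x + BT.smulHom A b x
    induction x using BT.induction with
    | h0 => simp only [map_zero, add_zero]
    | ht m e =>
      change BT.tmul A ((a + b) • m) e = BT.tmul A (a • m) e + BT.tmul A (b • m) e
      rw [add_smul, BT.add_tmul]
    | ha x y hx hy => simp only [map_add, hx, hy]; abel
  zero_smul x := by
    change BT.smulHom A 0 x = 0
    induction x using BT.induction with
    | h0 => simp only [map_zero]
    | ht m e =>
      change BT.tmul A ((0 : A) • m) e = 0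
      rw [zero_smul, BT.zero_tmul]
    | ha x y hx hy => simp only [map_add, hx, hy, add_zero]

theorem BT.map_smul (f : E →ₗ[A] F) (a : A) (x : BT A M E) :
    BT.map M f (a • x) = a • BT.map M f x := by
  induction x using BT.induction with
  | h0 => simp
  | ht m e => simp [BT.smul_def]
  | ha x y hx hy => simp only [smul_add, map_add, hx, hy]

end LeftModule

section Lift2

variable {N P : Type u} [AddCommGroup N] [Module A N] [Module Aᵐᵒᵖ N] [SMulCommClass A Aᵐᵒᵖ N]
variable [AddCommGroup P] [Module Aᵐᵒᵖ P]

variable {A} (E) in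
/-- The map `M ⊗_A N ⊗_A E → P ⊗_A E`, `m ⊗ n ⊗ e ↦ f m n ⊗ e`, given by a biadditive map
`f` that is balanced over `A` and right `A`-linear in the second variable. -/
def BT.lift₂ (f : M → N → P) (hl : ∀ m m' n, f (m + m') n = f m n + f m' n)
    (hr : ∀ m n n', f m (n + n') = f m n + f m n')
    (hb : ∀ m (a : A) n, f (op a • m) n = f m (a • n))
    (hc : ∀ m (a : A) n, f m (op a • n) = op a • f m n) :
    BT A M (BT A N E) →+ BT A P E :=
  BT.lift
    (fun m => BT.lift (fun n e => BT.tmul A (f m n) e)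
      (fun n n' e => by rw [hr, BT.add_tmul])
      (fun _ _ _ => BT.tmul_add A _ _ _)
      (fun n a e => by rw [hc, BT.smul_tmul]))
    (fun m m' y => by
      induction y using BT.induction with
      | h0 => simp
      | ht n e => simp only [BT.lift_tmul]; rw [hl, BT.add_tmul]
      | ha x y hx hy => simp only [map_add, hx, hy]; abel)
    (fun _ _ _ => map_add _ _ _)
    (fun m a y => by
      induction y using BT.induction with
      | h0 => simp
      | ht n e => simp only [BT.lift_tmul, BT.smul_def]; rw [hb]
      | ha x y hx hy => simp only [map_add, smul_add, hx, hy])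

@[simp] theorem BT.lift₂_tmul (f : M → N → P) (hl hr)
    (hb : ∀ m (a : A) n, f (op a • m) n = f m (a • n)) (hc) (m : M) (n : N) (e : E) :
    BT.lift₂ E f hl hr hb hc (BT.tmul A m (BT.tmul A n e)) = BT.tmul A (f m n) e := rfl

end Lift2


variable (M) in
/-- A right `A`-module `M` is flat if `M ⊗_A -` preserves injective maps of left `A`-modules. -/
def IsFlatRight : Prop :=
  ∀ (E F : Type u) [AddCommGroup E] [Module A E] [AddCommGroup F] [Module A F] (f : E →ₗ[A] F),
    Function.Injective f → Function.Injective (BT.map M f)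

end Balanced

/-- An exterior algebra over the `k`-algebra `A`: a differential graded `k`-algebra
`Ω = ⨁ₙ Ωⁿ` with `Ω⁰ = A` that is generated, as an algebra, by `A` and `dA`. -/
structure ExtAlg (k : Type v) (A : Type u) [CommRing k] [Ring A] [Algebra k A] where
  /-- the total algebra, whose product is the wedge product -/
  Ω : Type u
  [ring : Ring Ω]
  [algebra : Algebra k Ω]
  /-- the homogeneous pieces -/
  deg : ℕ → Submodule k Ω
  gradedMonoid : SetLike.GradedMonoid deg
  isInternal : DirectSum.IsInternal deg
  /-- the identification of `A` with the piece of degree zero -/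
  ofA : A →ₐ[k] Ω
  ofA_injective : Function.Injective ofA
  range_ofA : LinearMap.range ofA.toLinearMap = deg 0
  /-- the exterior derivative -/
  d : Ω →ₗ[k] Ω
  d_mem : ∀ n, ∀ ω ∈ deg n, d ω ∈ deg (n + 1)
  d_d : ∀ ω, d (d ω) = 0
  leibniz : ∀ n, ∀ ω ∈ deg n, ∀ η, d (ω * η) = d ω * η + (-1) ^ n * (ω * d η)
  generated : Algebra.adjoin k (Set.range ofA ∪ Set.range (fun a => d (ofA a))) = ⊤

attribute [instance] ExtAlg.ring ExtAlg.algebra ExtAlg.gradedMonoid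

variable {k : Type v} {A : Type u} [CommRing k] [Ring A] [Algebra k A]

namespace ExtAlg

variable (X : ExtAlg k A)

theorem ofA_mem (a : A) : X.ofA a ∈ X.deg 0 := by
  rw [← X.range_ofA]; exact ⟨a, rfl⟩

theorem mul_mem' {p q : ℕ} {x y : X.Ω} (hx : x ∈ X.deg p) (hy : y ∈ X.deg q) :
    x * y ∈ X.deg (p + q) := SetLike.mul_mem_graded hx hy

theorem ofA_mul_mem (a : A) {n : ℕ} {x : X.Ω} (hx : x ∈ X.deg n) : X.ofA a * x ∈ X.deg n := by
  simpa using X.mul_mem' (X.ofA_mem a) hx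

theorem mul_ofA_mem (a : A) {n : ℕ} {x : X.Ω} (hx : x ∈ X.deg n) : x * X.ofA a ∈ X.deg n := by
  simpa using X.mul_mem' hx (X.ofA_mem a)

theorem leibniz_ofA (a : A) (η : X.Ω) :
    X.d (X.ofA a * η) = X.d (X.ofA a) * η + X.ofA a * X.d η := by
  simpa using X.leibniz 0 _ (X.ofA_mem a) η

theorem d_one : X.d 1 = 0 := by
  have h := X.leibniz_ofA 1 1
  simpa using h

/-- The `A`-bimodule `Ωⁿ` of `n`-forms. -/
def Form (n : ℕ) : Type u := X.deg n

instance (n : ℕ) : AddCommGroup (X.Form n) := inferInstanceAs (AddCommGroup (X.deg n))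
instance (n : ℕ) : Module k (X.Form n) := inferInstanceAs (Module k (X.deg n))

/-- The inclusion of `Ωⁿ` in the total algebra. -/
def val (n : ℕ) : X.Form n →ₗ[k] X.Ω := (X.deg n).subtype

variable {X} in
theorem val_injective {n : ℕ} : Function.Injective (X.val n) := Subtype.val_injective

variable {X} in
theorem val_mem {n : ℕ} (ω : X.Form n) : X.val n ω ∈ X.deg n := ω.2

instance (n : ℕ) : SMul A (X.Form n) :=
  ⟨fun a ω => ⟨X.ofA a * X.val n ω, X.ofA_mul_mem a ω.2⟩⟩

instance (n : ℕ) : SMul Aᵐᵒᵖ (X.Form n) :=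
  ⟨fun a ω => ⟨X.val n ω * X.ofA a.unop, X.mul_ofA_mem a.unop ω.2⟩⟩

theorem val_smul (n : ℕ) (a : A) (ω : X.Form n) : X.val n (a • ω) = X.ofA a * X.val n ω := rfl

theorem val_op_smul (n : ℕ) (a : Aᵐᵒᵖ) (ω : X.Form n) :
    X.val n (a • ω) = X.val n ω * X.ofA a.unop := rfl

instance (n : ℕ) : Module A (X.Form n) where
  one_smul ω := val_injective (by simp [val_smul])
  mul_smul a b ω := val_injective (by simp [val_smul, mul_assoc])
  smul_zero a := val_injective (by simp [val_smul])
  smul_add a ω η := val_injective (by simp [val_smul, mul_add])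
  add_smul a b ω := val_injective (by simp [val_smul, add_mul])
  zero_smul ω := val_injective (by simp [val_smul])

instance (n : ℕ) : Module Aᵐᵒᵖ (X.Form n) where
  one_smul ω := val_injective (by simp [val_op_smul])
  mul_smul a b ω := val_injective (by simp [val_op_smul, mul_assoc])
  smul_zero a := val_injective (by simp [val_op_smul])
  smul_add a ω η := val_injective (by simp [val_op_smul, add_mul])
  add_smul a b ω := val_injective (by simp [val_op_smul, mul_add])
  zero_smul ω := val_injective (by simp [val_op_smul])

instance (n : ℕ) : SMulCommClass A Aᵐᵒᵖ (X.Form n) :=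
  ⟨fun a b ω => val_injective (by simp [val_smul, val_op_smul, mul_assoc])⟩

/-- The exterior algebra is flat as a right `A`-module: each `Ωⁿ` is. -/
def IsFlat : Prop := ∀ n, IsFlatRight A (X.Form n)

/-- The wedge product of forms. -/
def mulForm {p q : ℕ} (ω : X.Form p) (η : X.Form q) : X.Form (p + q) :=
  ⟨X.val p ω * X.val q η, X.mul_mem' (val_mem ω) (val_mem η)⟩

theorem val_mulForm {p q : ℕ} (ω : X.Form p) (η : X.Form q) :
    X.val (p + q) (X.mulForm ω η) = X.val p ω * X.val q η := rfl

/-- The exterior derivative `Ωⁿ → Ωⁿ⁺¹`. -/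
def dForm {n : ℕ} (ω : X.Form n) : X.Form (n + 1) :=
  ⟨X.d (X.val n ω), X.d_mem n _ (val_mem ω)⟩

/-- The unit `1 ∈ Ω⁰ = A`. -/
def oneForm : X.Form 0 := ⟨1, by simpa using X.ofA_mem 1⟩

section Wedge

variable (F : Type u) [AddCommGroup F] [Module A F]

/-- The map `Ωᵖ ⊗_A Ω^q ⊗_A F → Ω^(p+q) ⊗_A F`, `ω ⊗ η ⊗ f ↦ (ω ∧ η) ⊗ f`. -/
def wedge (p q : ℕ) : BT A (X.Form p) (BT A (X.Form q) F) →+ BT A (X.Form (p + q)) F :=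
  BT.lift₂ F (fun ω η => X.mulForm ω η)
    (fun _ _ _ => val_injective (by simp [val_mulForm, add_mul]))
    (fun _ _ _ => val_injective (by simp [val_mulForm, mul_add]))
    (fun _ _ _ => val_injective (by simp [val_mulForm, val_op_smul, val_smul, mul_assoc]))
    (fun _ _ _ => val_injective (by simp [val_mulForm, val_op_smul, mul_assoc]))

@[simp] theorem wedge_tmul (p q : ℕ) (ω : X.Form p) (η : X.Form q) (f : F) :
    X.wedge F p q (BT.tmul A ω (BT.tmul A η f)) = BT.tmul A (X.mulForm ω η) f := rfl

theorem wedge_smul (p q : ℕ) (a : A) (x : BT A (X.Form p) (BT A (X.Form q) F)) :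
    X.wedge F p q (a • x) = a • X.wedge F p q x := by
  induction x using BT.induction with
  | h0 => simp
  | ht ω y =>
    induction y using BT.induction with
    | h0 => simp [BT.tmul_zero]
    | ht η f =>
      rw [BT.smul_def, wedge_tmul, wedge_tmul, BT.smul_def]; congr 1
      exact val_injective (by simp [val_mulForm, val_smul, mul_assoc])
    | ha x y hx hy => simp only [BT.tmul_add, smul_add, map_add, hx, hy]
  | ha x y hx hy => simp only [smul_add, map_add, hx, hy]

end Wedge

/-! ### Symmetric forms and the `δ`-complex -/

/-- Two consecutive modules `Sⁿ E`, `Sⁿ⁺¹ E` of symmetric forms, with `Sⁿ⁺¹ E → Ω¹ ⊗_A Sⁿ E`. -/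
structure SymStage where
  prev : ModuleCat.{u} A
  cur : ModuleCat.{u} A
  incl : cur →ₗ[A] BT A (X.Form 1) prev

/-- The kernel of `Ω¹ Sⁿ⁺¹ E → Ω¹ Ω¹ Sⁿ E → Ω² Sⁿ E`, which is `Sⁿ⁺² E`. -/
def SymStage.ker {X : ExtAlg k A} (s : X.SymStage) : Submodule A (BT A (X.Form 1) s.cur) where
  carrier := {x | X.wedge s.prev 1 1 (BT.map (X.Form 1) s.incl x) = 0}
  zero_mem' := by simp
  add_mem' {x y} hx hy := by
    simp only [Set.mem_ofPred_eq, map_add] at *; rw [hx, hy, add_zero]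
  smul_mem' a x hx := by
    simp only [Set.mem_ofPred_eq] at *; rw [BT.map_smul, wedge_smul, hx, smul_zero]

/-- The passage from `(Sⁿ E, Sⁿ⁺¹ E)` to `(Sⁿ⁺¹ E, Sⁿ⁺² E)`. -/
def SymStage.next {X : ExtAlg k A} (s : X.SymStage) : X.SymStage where
  prev := s.cur
  cur := ModuleCat.of A s.ker
  incl := s.ker.subtype

section Sym

variable (E : Type u) [AddCommGroup E] [Module A E]

/-- The modules of symmetric forms with values in `E`, starting with `S⁰ E = E`,
`S¹ E = Ω¹ ⊗_A E`. -/
def symStage : ℕ → X.SymStage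
  | 0 => ⟨ModuleCat.of A E, ModuleCat.of A (BT A (X.Form 1) E), LinearMap.id⟩
  | n + 1 => (symStage n).next

/-- The module `Sⁿ E` of symmetric forms of degree `n`. -/
def Sym (n : ℕ) : Type u := (X.symStage E n).prev

instance (n : ℕ) : AddCommGroup (X.Sym E n) :=
  inferInstanceAs (AddCommGroup (X.symStage E n).prev)
instance (n : ℕ) : Module A (X.Sym E n) :=
  inferInstanceAs (Module A (X.symStage E n).prev)

/-- The canonical map `Sⁿ⁺¹ E → Ω¹ ⊗_A Sⁿ E`. -/
def symIncl (n : ℕ) : X.Sym E (n + 1) →ₗ[A] BT A (X.Form 1) (X.Sym E n) :=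
  (X.symStage E n).incl

theorem symIncl_wedge (n : ℕ) (s : X.Sym E (n + 2)) :
    X.wedge (X.Sym E n) 1 1 (BT.map (X.Form 1) (X.symIncl E n) (X.symIncl E (n + 1) s)) = 0 :=
  Subtype.property s

/-- The Spencer `δ`-operator `Ωᵐ Sⁿ⁺¹ E → Ωᵐ⁺¹ Sⁿ E`, `ω ⊗ s ↦ (-1)ᵐ ω ∧ s`. -/
def delta (n m : ℕ) :
    BT A (X.Form m) (X.Sym E (n + 1)) →+ BT A (X.Form (m + 1)) (X.Sym E n) :=
  ((-1 : ℤ) ^ m) • (X.wedge (X.Sym E n) m 1).comp (BT.map (X.Form m) (X.symIncl E n))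

theorem delta_delta (n m : ℕ) (x : BT A (X.Form m) (X.Sym E (n + 2))) :
    X.delta E n (m + 1) (X.delta E (n + 1) m x) = 0 := by
  have key : ∀ (ω : X.Form m) (y : BT A (X.Form 1) (X.Sym E (n + 1))),
      X.wedge (X.Sym E n) (m + 1) 1 (BT.map (X.Form (m + 1)) (X.symIncl E n)
        (X.wedge (X.Sym E (n + 1)) m 1 (BT.tmul A ω y))) =
      X.wedge (X.Sym E n) m 2 (BT.tmul A ω
        (X.wedge (X.Sym E n) 1 1 (BT.map (X.Form 1) (X.symIncl E n) y))) := by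
    intro ω y
    induction y using BT.induction with
    | h0 => simp [BT.tmul_zero]
    | ht η s =>
      rw [wedge_tmul, BT.map_tmul, BT.map_tmul]
      generalize X.symIncl E n s = z
      induction z using BT.induction with
      | h0 => simp [BT.tmul_zero]
      | ht θ t =>
        simp only [wedge_tmul]
        refine congrArg (fun w : X.Form (m + 2) => BT.tmul A w t) (val_injective ?_)
        exact mul_assoc _ _ _
      | ha x y hx hy => simp only [BT.tmul_add, map_add, hx, hy]
    | ha x y hx hy => simp only [BT.tmul_add, map_add, hx, hy]
  have h0 : X.wedge (X.Sym E n) (m + 1) 1 (BT.map (X.Form (m + 1)) (X.symIncl E n)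
        (X.wedge (X.Sym E (n + 1)) m 1 (BT.map (X.Form m) (X.symIncl E (n + 1)) x))) = 0 := by
    induction x using BT.induction with
    | h0 => simp
    | ht ω s => rw [BT.map_tmul, key, symIncl_wedge, BT.tmul_zero, map_zero]
    | ha x y hx hy => simp only [map_add, hx, hy, add_zero]
  simp only [delta, AddMonoidHom.smul_apply, AddMonoidHom.comp_apply, map_zsmul, h0, smul_zero]

/-- The cocycles of the `δ`-complex `0 → Sⁿ E → Ω¹ Sⁿ⁻¹ E → ⋯ → Ωⁿ ⊗_A E → 0` in `Ωᵐ Sⁿ E`. -/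
def deltaKer : (n m : ℕ) → AddSubgroup (BT A (X.Form m) (X.Sym E n))
  | 0, _ => ⊤
  | n + 1, m => (X.delta E n m).ker

/-- The coboundaries of the `δ`-complex in `Ωᵐ Sⁿ E`. -/
def deltaIm : (n m : ℕ) → AddSubgroup (BT A (X.Form m) (X.Sym E n))
  | _, 0 => ⊥
  | n, m + 1 => (X.delta E n m).range

theorem deltaIm_le_deltaKer : ∀ n m, X.deltaIm E n m ≤ X.deltaKer E n m
  | 0, _ => le_top
  | _ + 1, 0 => bot_le
  | n + 1, m + 1 => by
    rintro _ ⟨x, rfl⟩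
    exact X.delta_delta E n m x

/-- The Spencer `δ`-cohomology `H_δ^{n,m}(E)` at `Ωᵐ Sⁿ E`. -/
abbrev DeltaCohomology (n m : ℕ) : Type u :=
  X.deltaKer E n m ⧸ (X.deltaIm E n m).addSubgroupOf (X.deltaKer E n m)

end Sym

/-! ### The bimodule of 1-jets -/

/-- The map `A ⊗ A → Ω¹`, `a ⊗ b ↦ a db`. -/
def adb : A ⊗[k] A →ₗ[k] X.Ω :=
  LinearMap.mul' k X.Ω ∘ₗ TensorProduct.map X.ofA.toLinearMap (X.d ∘ₗ X.ofA.toLinearMap)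

@[simp] theorem adb_tmul (a b : A) : X.adb (a ⊗ₜ b) = X.ofA a * X.d (X.ofA b) := by
  simp [adb]

theorem mul'_smul (a : A) (x : A ⊗[k] A) :
    LinearMap.mul' k A (a • x) = a * LinearMap.mul' k A x := by
  induction x using TensorProduct.induction_on with
  | zero => simp
  | tmul b c => simp [TensorProduct.smul_tmul', mul_assoc]
  | add x y hx hy => simp only [smul_add, map_add, mul_add, hx, hy]

theorem adb_smul (a : A) (x : A ⊗[k] A) : X.adb (a • x) = X.ofA a * X.adb x := by
  induction x using TensorProduct.induction_on with
  | zero => simp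
  | tmul b c => simp [TensorProduct.smul_tmul', mul_assoc]
  | add x y hx hy => simp only [smul_add, map_add, mul_add, hx, hy]

/-- The sub-bimodule `N = {∑ aᵢ ⊗ bᵢ | ∑ aᵢ bᵢ = 0, ∑ aᵢ dbᵢ = 0}` of `A ⊗ A`. -/
def jetRel : Submodule A (A ⊗[k] A) where
  carrier := {x | LinearMap.mul' k A x = 0 ∧ X.adb x = 0}
  zero_mem' := by simp
  add_mem' {x y} hx hy := by
    simp only [Set.mem_ofPred_eq, map_add] at *; simp [hx, hy]
  smul_mem' a x hx := by
    simp only [Set.mem_ofPred_eq] at *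
    rw [mul'_smul, adb_smul, hx.1, hx.2, mul_zero, mul_zero]; exact ⟨rfl, rfl⟩

/-- Right multiplication by `c` on `A ⊗ A`: `a ⊗ b ↦ a ⊗ b c`. -/
def rmul (c : A) : A ⊗[k] A →ₗ[A] A ⊗[k] A :=
  TensorProduct.AlgebraTensorModule.map LinearMap.id (LinearMap.mulRight k c)

@[simp] theorem rmul_tmul (c a b : A) : rmul (k := k) c (a ⊗ₜ b) = a ⊗ₜ (b * c) := rfl

theorem mul'_rmul (c : A) (x : A ⊗[k] A) :
    LinearMap.mul' k A (rmul c x) = LinearMap.mul' k A x * c := by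
  induction x using TensorProduct.induction_on with
  | zero => simp
  | tmul a b => simp [mul_assoc]
  | add x y hx hy => simp only [map_add, add_mul, hx, hy]

theorem adb_rmul (c : A) (x : A ⊗[k] A) : X.adb (rmul c x) =
    X.adb x * X.ofA c + X.ofA (LinearMap.mul' k A x) * X.d (X.ofA c) := by
  induction x using TensorProduct.induction_on with
  | zero => simp
  | tmul a b => simp [leibniz_ofA, mul_add, mul_assoc]
  | add x y hx hy => simp only [map_add, add_mul, hx, hy]; abel

theorem jetRel_le_comap_rmul (c : A) : X.jetRel ≤ X.jetRel.comap (rmul c) := by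
  intro x hx
  refine ⟨?_, ?_⟩
  · rw [mul'_rmul, hx.1, zero_mul]
  · rw [adb_rmul, hx.1, hx.2]; simp

/-- The bimodule `J¹ A = (A ⊗ A) / N` of 1-jets. -/
def J1 : Type u := (A ⊗[k] A) ⧸ X.jetRel

instance : AddCommGroup X.J1 := inferInstanceAs (AddCommGroup ((A ⊗[k] A) ⧸ X.jetRel))
instance : Module A X.J1 := inferInstanceAs (Module A ((A ⊗[k] A) ⧸ X.jetRel))

/-- The class `[x]` in `J¹ A` of `x ∈ A ⊗ A`. -/
def jmk : A ⊗[k] A →ₗ[A] X.J1 := X.jetRel.mkQ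

/-- The right action `[a ⊗ b] c = [a ⊗ b c]` on `J¹ A`. -/
def j1Right (c : A) : X.J1 →ₗ[A] X.J1 :=
  X.jetRel.mapQ X.jetRel (rmul c) (X.jetRel_le_comap_rmul c)

instance : SMul Aᵐᵒᵖ X.J1 := ⟨fun c x => X.j1Right c.unop x⟩

theorem smul_jmk_tmul (c a b : A) : c • X.jmk (a ⊗ₜ b) = X.jmk ((c * a) ⊗ₜ b) := rfl

variable {X} in
@[elab_as_elim]
theorem J1.induction {P : X.J1 → Prop} (p : X.J1) (h0 : P 0)
    (ht : ∀ a b, P (X.jmk (a ⊗ₜ b))) (ha : ∀ p q, P p → P q → P (p + q)) : P p := by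
  obtain ⟨x, rfl⟩ := X.jetRel.mkQ_surjective p
  induction x using TensorProduct.induction_on with
  | zero => rw [map_zero]; exact h0
  | tmul a b => exact ht a b
  | add x y hx hy => rw [map_add]; exact ha _ _ hx hy

theorem op_smul_add' (c : Aᵐᵒᵖ) (p q : X.J1) : c • (p + q) = c • p + c • q :=
  map_add (X.j1Right c.unop) p q

theorem op_smul_zero' (c : Aᵐᵒᵖ) : c • (0 : X.J1) = 0 := map_zero (X.j1Right c.unop)

theorem op_smul_tmul (c : Aᵐᵒᵖ) (a b : A) :
    c • X.jmk (a ⊗ₜ b) = X.jmk (a ⊗ₜ (b * c.unop)) := rfl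

instance : Module Aᵐᵒᵖ X.J1 where
  smul_zero := X.op_smul_zero'
  smul_add := X.op_smul_add'
  one_smul p := by
    induction p using J1.induction with
    | h0 => exact op_smul_zero' _ _
    | ht a b => simp [op_smul_tmul]
    | ha p q hp hq => rw [op_smul_add', hp, hq]
  mul_smul c c' p := by
    induction p using J1.induction with
    | h0 => simp only [op_smul_zero']
    | ht a b => simp [op_smul_tmul, mul_assoc]
    | ha p q hp hq => simp only [op_smul_add', hp, hq]
  add_smul c c' p := by
    induction p using J1.induction with
    | h0 => simp only [op_smul_zero', add_zero]
    | ht a b => simp [op_smul_tmul, mul_add, TensorProduct.tmul_add]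
    | ha p q hp hq => simp only [op_smul_add', hp, hq]; abel
  zero_smul p := by
    induction p using J1.induction with
    | h0 => exact op_smul_zero' _ _
    | ht a b => simp [op_smul_tmul]
    | ha p q hp hq => rw [op_smul_add', hp, hq, add_zero]

instance : SMulCommClass A Aᵐᵒᵖ X.J1 := ⟨fun a c p => ((X.j1Right c.unop).map_smul a p).symm⟩

/-- The additive map on `J¹ A` given by a map on `A ⊗ A` that vanishes on the relations. -/
def descend (n : ℕ) (f : A ⊗[k] A →ₗ[k] X.Ω) (hm : ∀ x, f x ∈ X.deg n)
    (h : ∀ x ∈ X.jetRel, f x = 0) : X.J1 →+ X.Form n :=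
  QuotientAddGroup.lift X.jetRel.toAddSubgroup (f.codRestrict (X.deg n) hm).toAddMonoidHom
    (fun x hx => val_injective (h x hx))

@[simp] theorem val_descend (n : ℕ) (f : A ⊗[k] A →ₗ[k] X.Ω) (hm) (h) (x : A ⊗[k] A) :
    X.val n (X.descend n f hm h (X.jmk x)) = f x := rfl

theorem mem_of_tmul {n : ℕ} (f : A ⊗[k] A →ₗ[k] X.Ω) (h : ∀ a b, f (a ⊗ₜ b) ∈ X.deg n)
    (x : A ⊗[k] A) : f x ∈ X.deg n := by
  induction x using TensorProduct.induction_on with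
  | zero => simp
  | tmul a b => exact h a b
  | add x y hx hy => rw [map_add]; exact add_mem hx hy

/-! ### The Spencer operator on 1-jets -/

/-- The map `A ⊗ A → Ω`, `a ⊗ b ↦ d(ω a) b`. -/
def preSpencer (ω : X.Ω) : A ⊗[k] A →ₗ[k] X.Ω :=
  LinearMap.mul' k X.Ω ∘ₗ
    TensorProduct.map (X.d ∘ₗ LinearMap.mulLeft k ω ∘ₗ X.ofA.toLinearMap) X.ofA.toLinearMap

@[simp] theorem preSpencer_tmul (ω : X.Ω) (a b : A) :
    X.preSpencer ω (a ⊗ₜ b) = X.d (ω * X.ofA a) * X.ofA b := by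
  simp [preSpencer]

theorem preSpencer_eq {m : ℕ} {ω : X.Ω} (hω : ω ∈ X.deg m) (x : A ⊗[k] A) :
    X.preSpencer ω x = X.d ω * X.ofA (LinearMap.mul' k A x) +
      (-1) ^ m * (ω * (X.d (X.ofA (LinearMap.mul' k A x)) - X.adb x)) := by
  induction x using TensorProduct.induction_on with
  | zero => simp
  | tmul a b =>
    simp [X.leibniz m ω hω, leibniz_ofA, add_mul, mul_assoc]
  | add x y hx hy => simp only [map_add, hx, hy]; noncomm_ring

/-- The map `Ωᵐ × J¹ A → Ωᵐ⁺¹`, `(ω, [a ⊗ b]) ↦ d(ω a) b`. -/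
def spencerForm {m : ℕ} (ω : X.Form m) : X.J1 →+ X.Form (m + 1) :=
  X.descend (m + 1) (X.preSpencer (X.val m ω))
    (X.mem_of_tmul _ fun a b => by
      rw [preSpencer_tmul]
      exact X.mul_ofA_mem b (X.d_mem m _ (X.mul_ofA_mem a (val_mem ω))))
    (fun x hx => by rw [X.preSpencer_eq (val_mem ω), hx.1, hx.2]; simp)

theorem val_spencerForm {m : ℕ} (ω : X.Form m) (a b : A) :
    X.val (m + 1) (X.spencerForm ω (X.jmk (a ⊗ₜ b))) =
      X.d (X.val m ω * X.ofA a) * X.ofA b := by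
  rw [spencerForm, val_descend, preSpencer_tmul]

theorem spencerForm_add {m : ℕ} (ω ω' : X.Form m) (p : X.J1) :
    X.spencerForm (ω + ω') p = X.spencerForm ω p + X.spencerForm ω' p := by
  induction p using J1.induction with
  | h0 => simp
  | ht a b => exact val_injective (by simp [val_spencerForm, add_mul])
  | ha p q hp hq => simp only [map_add, hp, hq]; abel

theorem spencerForm_zero {m : ℕ} (p : X.J1) : X.spencerForm (0 : X.Form m) p = 0 := by
  have h := X.spencerForm_add (0 : X.Form m) 0 p
  rwa [add_zero, left_eq_add] at h

/-- The Spencer operator `Ωᵐ J¹ F → Ωᵐ⁺¹ F`, `ω ⊗ [a ⊗ b] ⊗ f ↦ d(ω a) b ⊗ f`. -/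
def spencerOne (F : Type u) [AddCommGroup F] [Module A F] (m : ℕ) :
    BT A (X.Form m) (BT A X.J1 F) →+ BT A (X.Form (m + 1)) F :=
  BT.lift₂ F (fun ω p => X.spencerForm ω p)
    X.spencerForm_add
    (fun _ _ _ => map_add _ _ _)
    (fun ω c p => by
      induction p using J1.induction with
      | h0 => simp
      | ht a b => exact val_injective (by
          simp [val_spencerForm, val_op_smul, smul_jmk_tmul, mul_assoc])
      | ha p q hp hq => simp only [map_add, smul_add, hp, hq])
    (fun ω c p => by
      induction p using J1.induction with
      | h0 => simp
      | ht a b => exact val_injective (by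
          simp [val_spencerForm, val_op_smul, op_smul_tmul, mul_assoc])
      | ha p q hp hq => simp only [map_add, smul_add, hp, hq])

@[simp] theorem spencerOne_tmul (F : Type u) [AddCommGroup F] [Module A F] (m : ℕ)
    (ω : X.Form m) (p : X.J1) (f : F) :
    X.spencerOne F m (BT.tmul A ω (BT.tmul A p f)) = BT.tmul A (X.spencerForm ω p) f := rfl

/-! ### The operator whose kernel cuts out the holonomic jets -/

/-- The map `J¹ A → Ω¹`, `[a ⊗ b] ↦ (da) b`. -/
def dab (p : X.J1) : X.Ω := X.val 1 (X.spencerForm X.oneForm p)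

@[simp] theorem dab_jmk (a b : A) : X.dab (X.jmk (a ⊗ₜ b)) = X.d (X.ofA a) * X.ofA b := by
  refine (X.val_spencerForm X.oneForm a b).trans ?_
  change X.d (1 * X.ofA a) * X.ofA b = _
  rw [one_mul]

theorem dab_add (p q : X.J1) : X.dab (p + q) = X.dab p + X.dab q := by
  simp [dab]

@[simp] theorem dab_zero : X.dab 0 = 0 := by simp [dab]

theorem dab_mem (p : X.J1) : X.dab p ∈ X.deg 1 := val_mem _

theorem dab_op_smul (c : A) (p : X.J1) : X.dab (op c • p) = X.dab p * X.ofA c := by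
  induction p using J1.induction with
  | h0 => simp
  | ht a b => simp [op_smul_tmul, mul_assoc]
  | ha p q hp hq => simp only [smul_add, dab_add, add_mul, hp, hq]

/-- The product map `J¹ A → A`, `[a ⊗ b] ↦ a b`. -/
def jproj : X.J1 →+ A :=
  QuotientAddGroup.lift X.jetRel.toAddSubgroup (LinearMap.mul' k A).toAddMonoidHom
    (fun _ hx => hx.1)

@[simp] theorem jproj_jmk (a b : A) : X.jproj (X.jmk (a ⊗ₜ b)) = a * b :=
  LinearMap.mul'_apply (R := k)

theorem dab_smul (b : A) (q : X.J1) :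
    X.dab (b • q) = X.ofA b * X.dab q + X.d (X.ofA b) * X.ofA (X.jproj q) := by
  induction q using J1.induction with
  | h0 => simp
  | ht c f => simp [smul_jmk_tmul, leibniz_ofA, add_mul, mul_assoc, add_comm]
  | ha p q hp hq => simp only [smul_add, dab_add, map_add, mul_add, hp, hq]; abel

/-- For `q ∈ J¹ A`, the map `A → Ω¹`, `b ↦ dab (b q)`; for `q = [c ⊗ f]` it is
`b ↦ d(b c) f`. -/
def dabLeft (q : X.J1) : A →ₗ[k] X.Ω where
  toFun b := X.dab (b • q)
  map_add' b b' := by rw [add_smul, dab_add]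
  map_smul' r b := by
    simp only [dab_smul, map_smul, smul_add, smul_mul_assoc, RingHom.id_apply]

@[simp] theorem dabLeft_apply (q : X.J1) (b : A) : X.dabLeft q b = X.dab (b • q) := rfl

/-- For `q = [c ⊗ f]`, the map `A ⊗ A → Ω¹`, `a ⊗ b ↦ a d(b c) f`. -/
def preDI (q : X.J1) : A ⊗[k] A →ₗ[k] X.Ω :=
  LinearMap.mul' k X.Ω ∘ₗ TensorProduct.map X.ofA.toLinearMap (X.dabLeft q)

/-- For `q = [c ⊗ f]`, the map `A ⊗ A → Ω²`, `a ⊗ b ↦ da ∧ d(b c) f`. -/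
def preDII (q : X.J1) : A ⊗[k] A →ₗ[k] X.Ω :=
  LinearMap.mul' k X.Ω ∘ₗ TensorProduct.map (X.d ∘ₗ X.ofA.toLinearMap) (X.dabLeft q)

@[simp] theorem preDI_tmul (q : X.J1) (a b : A) :
    X.preDI q (a ⊗ₜ b) = X.ofA a * X.dab (b • q) := by simp [preDI]

@[simp] theorem preDII_tmul (q : X.J1) (a b : A) :
    X.preDII q (a ⊗ₜ b) = X.d (X.ofA a) * X.dab (b • q) := by simp [preDII]

theorem preDI_eq (q : X.J1) (x : A ⊗[k] A) : X.preDI q x =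
    X.ofA (LinearMap.mul' k A x) * X.dab q + X.adb x * X.ofA (X.jproj q) := by
  induction x using TensorProduct.induction_on with
  | zero => simp
  | tmul a b => simp [dab_smul, mul_add, mul_assoc]
  | add x y hx hy => simp only [map_add, hx, hy]; noncomm_ring

theorem preDII_eq (q : X.J1) (x : A ⊗[k] A) : X.preDII q x =
    (X.d (X.ofA (LinearMap.mul' k A x)) - X.adb x) * X.dab q +
      X.d (X.adb x) * X.ofA (X.jproj q) := by
  induction x using TensorProduct.induction_on with
  | zero => simp
  | tmul a b => simp [dab_smul, leibniz_ofA, mul_add, X.d_d, mul_assoc]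
  | add x y hx hy => simp only [map_add, hx, hy]; noncomm_ring

/-- The map `J¹ A × J¹ A → Ω¹`, `([a ⊗ b], [c ⊗ f]) ↦ a d(b c) f`. -/
def formDI (q : X.J1) : X.J1 →+ X.Form 1 :=
  X.descend 1 (X.preDI q)
    (X.mem_of_tmul _ fun a b => by
      rw [preDI_tmul]; exact X.ofA_mul_mem a (X.dab_mem _))
    (fun x hx => by rw [preDI_eq, hx.1, hx.2]; simp)

/-- The map `J¹ A × J¹ A → Ω²`, `([a ⊗ b], [c ⊗ f]) ↦ da ∧ d(b c) f`. -/
def formDII (q : X.J1) : X.J1 →+ X.Form 2 :=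
  X.descend 2 (X.preDII q)
    (X.mem_of_tmul _ fun a b => by
      rw [preDII_tmul]
      exact X.mul_mem' (p := 1) (q := 1) (X.d_mem 0 _ (X.ofA_mem a)) (X.dab_mem _))
    (fun x hx => by rw [preDII_eq, hx.1, hx.2]; simp)

theorem val_formDI (q : X.J1) (a b : A) :
    X.val 1 (X.formDI q (X.jmk (a ⊗ₜ b))) = X.ofA a * X.dab (b • q) := by
  rw [formDI, val_descend, preDI_tmul]

theorem val_formDII (q : X.J1) (a b : A) :
    X.val 2 (X.formDII q (X.jmk (a ⊗ₜ b))) = X.d (X.ofA a) * X.dab (b • q) := by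
  rw [formDII, val_descend, preDII_tmul]

theorem formDI_add (q q' p : X.J1) :
    X.formDI (q + q') p = X.formDI q p + X.formDI q' p := by
  induction p using J1.induction with
  | h0 => simp
  | ht a b => exact val_injective (by simp [val_formDI, dab_add, mul_add])
  | ha p q hp hq => simp only [map_add, hp, hq]; abel

theorem formDI_zero (p : X.J1) : X.formDI 0 p = 0 := by
  have h := X.formDI_add 0 0 p
  rwa [add_zero, left_eq_add] at h

theorem formDII_add (q q' p : X.J1) :
    X.formDII (q + q') p = X.formDII q p + X.formDII q' p := by
  induction p using J1.induction with
  | h0 => simp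
  | ht a b => exact val_injective (by simp [val_formDII, dab_add, mul_add])
  | ha p q hp hq => simp only [map_add, hp, hq]; abel

theorem formDII_zero (p : X.J1) : X.formDII 0 p = 0 := by
  have h := X.formDII_add 0 0 p
  rwa [add_zero, left_eq_add] at h

theorem spencerForm_spencerForm {m : ℕ} (ω : X.Form m) (p q : X.J1) :
    X.val (m + 2) (X.spencerForm (X.spencerForm ω p) q) =
      (-1) ^ (m + 1) * (X.d (X.val m ω) * X.val 1 (X.formDI q p)) -
        X.val m ω * X.val 2 (X.formDII q p) := by
  induction p using J1.induction with
  | h0 => rw [map_zero, spencerForm_zero]; simp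
  | ha p p' hp hp' =>
    rw [map_add, spencerForm_add, map_add, hp, hp']; simp only [map_add]; noncomm_ring
  | ht a b =>
    induction q using J1.induction with
    | h0 => simp [formDI_zero, formDII_zero]
    | ha q q' hq hq' =>
      rw [map_add, map_add, hq, hq', formDI_add, formDII_add]; simp only [map_add]; noncomm_ring
    | ht c f =>
      rw [val_spencerForm, val_spencerForm, val_formDI, val_formDII, smul_jmk_tmul, dab_jmk,
        mul_assoc (X.d _), ← map_mul,
        X.leibniz (m + 1) _ (X.d_mem m _ (X.mul_ofA_mem a (val_mem ω))), X.d_d,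
        X.leibniz m _ (val_mem ω)]
      rcases neg_one_pow_eq_or X.Ω m with h | h <;> rw [pow_succ, h] <;> noncomm_ring

section Holonomic

variable (F : Type u) [AddCommGroup F] [Module A F]

/-- The `Ω¹`-component `J¹ J¹ F → Ω¹ F`,
`[a ⊗ b] ⊗ [c ⊗ f] ⊗ e ↦ a d(b c) f ⊗ e`, of the operator that defines holonomic jets. -/
def DI : BT A X.J1 (BT A X.J1 F) →+ BT A (X.Form 1) F :=
  BT.lift₂ F (fun p q => X.formDI q p)
    (fun _ _ _ => map_add _ _ _)
    (fun p q q' => X.formDI_add q q' p)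
    (fun p c q => by
      induction p using J1.induction with
      | h0 => simp
      | ht a b => exact val_injective (by simp [val_formDI, op_smul_tmul, mul_smul])
      | ha p q hp hq => simp only [map_add, smul_add, hp, hq])
    (fun p c q => by
      induction p using J1.induction with
      | h0 => simp
      | ht a b => exact val_injective (by
          rw [val_formDI, smul_comm, dab_op_smul, val_op_smul, val_formDI, unop_op, mul_assoc])
      | ha p q hp hq => simp only [map_add, smul_add, hp, hq])

/-- The `Ω²`-component `J¹ J¹ F → Ω² F`,
`[a ⊗ b] ⊗ [c ⊗ f] ⊗ e ↦ da ∧ d(b c) f ⊗ e`, of the operator that defines holonomic jets. -/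
def DII : BT A X.J1 (BT A X.J1 F) →+ BT A (X.Form 2) F :=
  BT.lift₂ F (fun p q => X.formDII q p)
    (fun _ _ _ => map_add _ _ _)
    (fun p q q' => X.formDII_add q q' p)
    (fun p c q => by
      induction p using J1.induction with
      | h0 => simp
      | ht a b => exact val_injective (by simp [val_formDII, op_smul_tmul, mul_smul])
      | ha p q hp hq => simp only [map_add, smul_add, hp, hq])
    (fun p c q => by
      induction p using J1.induction with
      | h0 => simp
      | ht a b => exact val_injective (by
          rw [val_formDII, smul_comm, dab_op_smul, val_op_smul, val_formDII, unop_op, mul_assoc])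
      | ha p q hp hq => simp only [map_add, smul_add, hp, hq])

@[simp] theorem DI_tmul (p q : X.J1) (e : F) :
    X.DI F (BT.tmul A p (BT.tmul A q e)) = BT.tmul A (X.formDI q p) e := rfl

@[simp] theorem DII_tmul (p q : X.J1) (e : F) :
    X.DII F (BT.tmul A p (BT.tmul A q e)) = BT.tmul A (X.formDII q p) e := rfl

theorem DI_smul (c : A) (x : BT A X.J1 (BT A X.J1 F)) : X.DI F (c • x) = c • X.DI F x := by
  induction x using BT.induction with
  | h0 => simp
  | ha x y hx hy => simp only [smul_add, map_add, hx, hy]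
  | ht p y =>
    induction y using BT.induction with
    | h0 => simp [BT.tmul_zero]
    | ha x y hx hy => simp only [BT.tmul_add, smul_add, map_add, hx, hy]
    | ht q e =>
      rw [BT.smul_def, DI_tmul, DI_tmul, BT.smul_def]; congr 1
      induction p using J1.induction with
      | h0 => simp
      | ht a b => exact val_injective (by
          simp [val_formDI, smul_jmk_tmul, val_smul, mul_assoc])
      | ha p q hp hq => simp only [map_add, smul_add, hp, hq]

/-- The differential `dc ∈ Ω¹` of `c ∈ A`. -/
def dA (c : A) : X.Form 1 := ⟨X.d (X.ofA c), X.d_mem 0 _ (X.ofA_mem c)⟩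

theorem val_dA (c : A) : X.val 1 (X.dA c) = X.d (X.ofA c) := rfl

theorem DII_smul (c : A) (x : BT A X.J1 (BT A X.J1 F)) :
    X.DII F (c • x) = c • X.DII F x + X.wedge F 1 1 (BT.tmul A (X.dA c) (X.DI F x)) := by
  induction x using BT.induction with
  | h0 => simp [BT.tmul_zero]
  | ha x y hx hy => simp only [smul_add, map_add, BT.tmul_add, hx, hy]; abel
  | ht p y =>
    induction y using BT.induction with
    | h0 => simp [BT.tmul_zero]
    | ha x y hx hy => simp only [BT.tmul_add, smul_add, map_add, hx, hy]; abel
    | ht q e =>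
      rw [BT.smul_def, DII_tmul, DII_tmul, BT.smul_def, DI_tmul, wedge_tmul]
      refine Eq.trans ?_ (BT.add_tmul (M := X.Form 2) A _ _ e)
      congr 1
      refine val_injective ?_
      rw [map_add]
      change _ = _ + X.d (X.ofA c) * X.val 1 (X.formDI q p)
      induction p using J1.induction with
      | h0 => simp
      | ht a b =>
        simp [val_formDI, val_formDII, smul_jmk_tmul, val_smul, leibniz_ofA, add_mul, mul_assoc,
          add_comm]
      | ha p p' hp hp' => simp only [map_add, smul_add, hp, hp', mul_add]; abel

theorem spencerOne_spencerOne (m : ℕ) (ω : X.Form m) (x : BT A X.J1 (BT A X.J1 F)) :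
    X.spencerOne F (m + 1) (X.spencerOne (BT A X.J1 F) m (BT.tmul A ω x)) =
      (-1 : ℤ) ^ (m + 1) • X.wedge F (m + 1) 1 (BT.tmul A (X.dForm ω) (X.DI F x)) -
        X.wedge F m 2 (BT.tmul A ω (X.DII F x)) := by
  induction x using BT.induction with
  | h0 => simp [BT.tmul_zero]
  | ha x y hx hy => simp only [map_add, BT.tmul_add, hx, hy, smul_add]; abel
  | ht p y =>
    induction y using BT.induction with
    | h0 => simp [BT.tmul_zero]
    | ha x y hx hy => simp only [map_add, BT.tmul_add, hx, hy, smul_add]; abel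
    | ht q e =>
      rw [spencerOne_tmul, spencerOne_tmul, DI_tmul, DII_tmul, wedge_tmul, wedge_tmul]
      have key : X.spencerForm (X.spencerForm ω p) q =
          (-1 : ℤ) ^ (m + 1) • X.mulForm (p := m + 1) (q := 1) (X.dForm ω) (X.formDI q p) -
            X.mulForm (p := m) (q := 2) ω (X.formDII q p) := by
        refine val_injective ((X.spencerForm_spencerForm ω p q).trans ?_)
        refine Eq.trans ?_ (map_sub (X.val (m + 2)) _ _).symm
        refine congrArg₂ (· - ·) ?_ rfl
        refine Eq.trans ?_ (map_zsmul (X.val (m + 2)) _ _).symm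
        change _ = (-1 : ℤ) ^ (m + 1) • (X.d (X.val m ω) * X.val 1 (X.formDI q p))
        rw [zsmul_eq_mul]; push_cast; rfl
      let τ : X.Form (m + 2) →+ BT A (X.Form (m + 2)) F :=
        AddMonoidHom.mk' (fun w => BT.tmul A w e) (fun _ _ => BT.add_tmul A _ _ _)
      refine (congrArg τ key).trans ?_
      refine (map_sub τ _ _).trans (congrArg₂ (· - ·) (map_zsmul τ _ _) rfl)

end Holonomic

/-! ### Holonomic jets and the Spencer complex -/

/-- Two consecutive jet modules `Jⁿ E`, `Jⁿ⁺¹ E`, with `Jⁿ⁺¹ E → J¹ Jⁿ E`. -/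
structure JetStage where
  prev : ModuleCat.{u} A
  cur : ModuleCat.{u} A
  incl : cur →ₗ[A] BT A X.J1 prev

/-- The kernel of `J¹ Jⁿ⁺¹ E → J¹ J¹ Jⁿ E → (Ω¹ ⋉ Ω²) Jⁿ E`, which is `Jⁿ⁺² E`. -/
def JetStage.ker {X : ExtAlg k A} (s : X.JetStage) : Submodule A (BT A X.J1 s.cur) where
  carrier := {x | X.DI s.prev (BT.map X.J1 s.incl x) = 0 ∧
    X.DII s.prev (BT.map X.J1 s.incl x) = 0}
  zero_mem' := by simp
  add_mem' {x y} hx hy := by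
    simp only [Set.mem_ofPred_eq, map_add] at *; simp [hx, hy]
  smul_mem' a x hx := by
    simp only [Set.mem_ofPred_eq] at *
    rw [BT.map_smul, DI_smul, DII_smul, hx.1, hx.2, BT.tmul_zero]; simp

/-- The passage from `(Jⁿ E, Jⁿ⁺¹ E)` to `(Jⁿ⁺¹ E, Jⁿ⁺² E)`. -/
def JetStage.next {X : ExtAlg k A} (s : X.JetStage) : X.JetStage where
  prev := s.cur
  cur := ModuleCat.of A s.ker
  incl := s.ker.subtype

section Jet

variable (E : Type u) [AddCommGroup E] [Module A E]

/-- The jet modules of `E`, starting with `J⁰ E = E`, `J¹ E = J¹ A ⊗_A E`. -/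
def jetStage : ℕ → X.JetStage
  | 0 => ⟨ModuleCat.of A E, ModuleCat.of A (BT A X.J1 E), LinearMap.id⟩
  | n + 1 => (jetStage n).next

/-- The module `Jⁿ E` of holonomic `n`-jets. -/
def Jet (n : ℕ) : Type u := (X.jetStage E n).prev

instance (n : ℕ) : AddCommGroup (X.Jet E n) :=
  inferInstanceAs (AddCommGroup (X.jetStage E n).prev)
instance (n : ℕ) : Module A (X.Jet E n) :=
  inferInstanceAs (Module A (X.jetStage E n).prev)

/-- The canonical map `Jⁿ⁺¹ E → J¹ Jⁿ E`. -/
def jetIncl (n : ℕ) : X.Jet E (n + 1) →ₗ[A] BT A X.J1 (X.Jet E n) :=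
  (X.jetStage E n).incl

theorem jetIncl_DI (n : ℕ) (ξ : X.Jet E (n + 2)) :
    X.DI (X.Jet E n) (BT.map X.J1 (X.jetIncl E n) (X.jetIncl E (n + 1) ξ)) = 0 :=
  (Subtype.property ξ).1

theorem jetIncl_DII (n : ℕ) (ξ : X.Jet E (n + 2)) :
    X.DII (X.Jet E n) (BT.map X.J1 (X.jetIncl E n) (X.jetIncl E (n + 1) ξ)) = 0 :=
  (Subtype.property ξ).2

variable {E} in
/-- The 1-jet prolongation `E → J¹ E`, `e ↦ [1 ⊗ 1] ⊗ e`. -/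
def prolongOne : E →+ BT A X.J1 E :=
  AddMonoidHom.mk' (fun e => BT.tmul A (X.jmk (1 ⊗ₜ 1)) e) (BT.tmul_add A _)

theorem prolongOne_mem (s : X.JetStage) (x : s.cur) (y : s.prev)
    (h : s.incl x = X.prolongOne y) : X.prolongOne x ∈ s.ker := by
  change X.DI s.prev (BT.map X.J1 s.incl (BT.tmul A (X.jmk (1 ⊗ₜ 1)) x)) = 0 ∧
    X.DII s.prev (BT.map X.J1 s.incl (BT.tmul A (X.jmk (1 ⊗ₜ 1)) x)) = 0
  rw [BT.map_tmul, h]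
  change X.DI s.prev (BT.tmul A _ (BT.tmul A _ y)) = 0 ∧
    X.DII s.prev (BT.tmul A _ (BT.tmul A _ y)) = 0
  rw [DI_tmul, DII_tmul]
  have h1 : X.formDI (X.jmk (1 ⊗ₜ 1)) (X.jmk (1 ⊗ₜ 1)) = 0 :=
    val_injective (by simp [val_formDI, d_one])
  have h2 : X.formDII (X.jmk (1 ⊗ₜ 1)) (X.jmk (1 ⊗ₜ 1)) = 0 :=
    val_injective (by simp [val_formDII, d_one])
  rw [h1, h2, BT.zero_tmul, BT.zero_tmul]; exact ⟨rfl, rfl⟩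

/-- The prolongations `jⁿ : E → Jⁿ E` and `jⁿ⁺¹ : E → Jⁿ⁺¹ E`, where `jⁿ⁺¹` is the
corestriction of `E → Jⁿ E → J¹ Jⁿ E`. -/
def prolongPair : (n : ℕ) → {p : (E →+ X.Jet E n) × (E →+ X.Jet E (n + 1)) //
    ∀ e, X.jetIncl E n (p.2 e) = X.prolongOne (p.1 e)}
  | 0 => ⟨(AddMonoidHom.id E, X.prolongOne), fun _ => rfl⟩
  | n + 1 =>
    let p := prolongPair n
    ⟨(p.1.2, AddMonoidHom.mk'
      (fun e => (⟨X.prolongOne (p.1.2 e), X.prolongOne_mem (X.jetStage E n) _ _ (p.2 e)⟩ :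
        (X.jetStage E n).ker))
      (fun e e' => Subtype.ext
        ((congrArg (X.prolongOne (E := X.Jet E (n + 1))) (map_add p.1.2 e e')).trans
          (map_add (X.prolongOne (E := X.Jet E (n + 1))) (p.1.2 e) (p.1.2 e'))))), fun _ => rfl⟩

/-- The `n`-jet prolongation `jⁿ : E → Jⁿ E`. -/
def prolong (n : ℕ) : E →+ X.Jet E n := (X.prolongPair E n).1.1

theorem prolong_zero (e : E) : X.prolong E 0 e = e := rfl

theorem jetIncl_prolong (n : ℕ) (e : E) :
    X.jetIncl E n (X.prolong E (n + 1) e) = X.prolongOne (X.prolong E n e) :=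
  (X.prolongPair E n).2 e

/-- The Spencer operator `Ωᵐ Jⁿ⁺¹ E → Ωᵐ⁺¹ Jⁿ E`,
`ω ⊗ ∑ [yⱼ ⊗ zⱼ] ⊗ ξⱼ ↦ ∑ d(ω yⱼ) zⱼ ⊗ ξⱼ`. -/
def spencer (n m : ℕ) :
    BT A (X.Form m) (X.Jet E (n + 1)) →+ BT A (X.Form (m + 1)) (X.Jet E n) :=
  (X.spencerOne (X.Jet E n) m).comp (BT.map (X.Form m) (X.jetIncl E n))

/-- The map `E → Jⁿ E ≅ Ω⁰ ⊗_A Jⁿ E` that starts the Spencer complex. -/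
def augment (n : ℕ) : E →+ BT A (X.Form 0) (X.Jet E n) :=
  AddMonoidHom.mk' (fun e => BT.tmul A X.oneForm (X.prolong E n e))
    (fun e e' => by rw [map_add, BT.tmul_add])

theorem spencer_augment (n : ℕ) (e : E) : X.spencer E n 0 (X.augment E (n + 1) e) = 0 := by
  change X.spencerOne _ 0 (BT.tmul A X.oneForm (X.jetIncl E n (X.prolong E (n + 1) e))) = 0
  rw [jetIncl_prolong]
  change BT.tmul A (X.spencerForm X.oneForm (X.jmk (1 ⊗ₜ 1))) _ = 0
  have h : X.spencerForm X.oneForm (X.jmk (1 ⊗ₜ 1)) = 0 :=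
    val_injective ((X.dab_jmk 1 1).trans (by simp [d_one]))
  rw [h, BT.zero_tmul]

theorem map_spencerOne {F G : Type u} [AddCommGroup F] [Module A F] [AddCommGroup G] [Module A G]
    (f : F →ₗ[A] G) (g : BT A X.J1 F →ₗ[A] BT A X.J1 G) (hg : ∀ y, g y = BT.map X.J1 f y) (m : ℕ)
    (x : BT A (X.Form m) (BT A X.J1 F)) :
    BT.map (X.Form (m + 1)) f (X.spencerOne F m x) =
      X.spencerOne G m (BT.map (X.Form m) g x) := by
  induction x using BT.induction with
  | h0 => simp
  | ha x y hx hy => simp only [map_add, hx, hy]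
  | ht ω y =>
    rw [BT.map_tmul, hg]
    induction y using BT.induction with
    | h0 => simp [BT.tmul_zero]
    | ha x y hx hy => simp only [BT.tmul_add, map_add, hx, hy]
    | ht p f => rfl

theorem spencer_spencer (n m : ℕ) (x : BT A (X.Form m) (X.Jet E (n + 2))) :
    X.spencer E n (m + 1) (X.spencer E (n + 1) m x) = 0 := by
  let g : BT A X.J1 (X.Jet E (n + 1)) →ₗ[A] BT A X.J1 (BT A X.J1 (X.Jet E n)) :=
    { toFun := BT.map X.J1 (X.jetIncl E n)
      map_add' := map_add _
      map_smul' := BT.map_smul A _ }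
  change X.spencerOne _ (m + 1) (BT.map _ (X.jetIncl E n) (X.spencerOne _ m _)) = 0
  rw [X.map_spencerOne (X.jetIncl E n) g (fun _ => rfl)]
  induction x using BT.induction with
  | h0 => simp
  | ha x y hx hy => simp only [map_add, hx, hy, add_zero]
  | ht ω ξ =>
    rw [BT.map_tmul, BT.map_tmul, spencerOne_spencerOne]
    change _ • X.wedge _ _ 1 (BT.tmul A _ (X.DI _ (BT.map X.J1 (X.jetIncl E n) _))) -
      X.wedge _ _ 2 (BT.tmul A _ (X.DII _ (BT.map X.J1 (X.jetIncl E n) _))) = 0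
    rw [jetIncl_DI, jetIncl_DII, BT.tmul_zero, BT.tmul_zero]
    simp

/-- The cocycles in `Ωᵐ Jⁿ E` of the Spencer complex
`0 → E → J^(n+m) E → Ω¹ J^(n+m-1) E → ⋯ → Ω^(n+m) ⊗_A E → 0`. -/
def spencerKer : (n m : ℕ) → AddSubgroup (BT A (X.Form m) (X.Jet E n))
  | 0, _ => ⊤
  | n + 1, m => (X.spencer E n m).ker

/-- The coboundaries of the Spencer complex in `Ωᵐ Jⁿ E`. -/
def spencerIm : (n m : ℕ) → AddSubgroup (BT A (X.Form m) (X.Jet E n))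
  | n, 0 => (X.augment E n).range
  | n, m + 1 => (X.spencer E n m).range

theorem spencerIm_le_spencerKer : ∀ n m, X.spencerIm E n m ≤ X.spencerKer E n m
  | 0, _ => le_top
  | n + 1, 0 => by
    rintro _ ⟨e, rfl⟩
    exact X.spencer_augment E n e
  | n + 1, m + 1 => by
    rintro _ ⟨x, rfl⟩
    exact X.spencer_spencer E n m x

/-- The Spencer cohomology `H_S^{n,m}(E)` at `Ωᵐ Jⁿ E`. -/
abbrev SpencerCohomology (n m : ℕ) : Type u :=
  X.spencerKer E n m ⧸ (X.spencerIm E n m).addSubgroupOf (X.spencerKer E n m)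

end Jet

end ExtAlg

end NCJet

/-! As an additive group, `J¹ A` splits as `A ⊕ Ω¹` through `[a ⊗ b] ↦ (ab, (da) b)`; this rests on
`Ω¹ = A dA` (`deg_one_le_range_adb`, `J1.ext`). Hence `J¹ F` splits as `F ⊕ Ω¹ F`, and an element of
`Jⁿ⁺² E` becomes a pair `(η, θ)` in `Jⁿ⁺¹ E ⊕ Ω¹ Jⁿ⁺¹ E`. By `DI_eq` and `DII_eq` the holonomy
conditions on it say that `θ` projects to `D η` in `Ω¹ Jⁿ E`, where `D` is the Spencer operator in
form degree zero, and that the Spencer operator kills `θ`.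

On jets with zero projection the Spencer operator is `δ`, so flatness identifies the kernel of `Jⁿ⁺¹
E → Jⁿ E` with `Sⁿ⁺¹ E` (`exact_symJet_holProj`). The obstruction to lifting an `(n+1)`-jet to an
`(n+2)`-jet is a class in `H_δ^{n,2}(E)`, so under the hypothesis all projections are surjective
(`holProj_surjective`).

Tensoring with the flat modules `Ωᵐ` then gives a short exact sequence of complexes: the `δ`-complex
of order `N+1`, the Spencer complex of order `N+1`, and the Spencer complex of order `N`. The first
is exact by hypothesis, so exactness passes from order `N` to order `N+1`; `spencerKer_le_spencerIm`
does this chase at each spot. The prolongations are injective because they project to `j⁰ = id`. -/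

namespace NCJet

/-! ### Exactness of the tensor product over a noncommutative ring -/

section BalancedExactness

variable {A : Type u} [Ring A] {M : Type u} [AddCommGroup M] [Module Aᵐᵒᵖ M]
variable {E F G : Type u} [AddCommGroup E] [Module A E] [AddCommGroup F] [Module A F]
  [AddCommGroup G] [Module A G]

theorem BT.map_comp (f : E →ₗ[A] F) (g : F →ₗ[A] G) (x : BT A M E) :
    BT.map M (g ∘ₗ f) x = BT.map M g (BT.map M f x) := by
  induction x using BT.induction with
  | h0 => simp
  | ht m e => rfl
  | ha x y hx hy => simp only [map_add, hx, hy]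

theorem BT.map_id (x : BT A M E) : BT.map M (LinearMap.id : E →ₗ[A] E) x = x := by
  induction x using BT.induction with
  | h0 => simp
  | ht m e => rfl
  | ha x y hx hy => simp only [map_add, hx, hy]

theorem BT.map_zero (x : BT A M E) : BT.map M (0 : E →ₗ[A] F) x = 0 := by
  induction x using BT.induction with
  | h0 => simp
  | ht m e => exact BT.tmul_zero A m
  | ha x y hx hy => simp only [map_add, hx, hy, add_zero]

theorem BT.map_surjective {f : E →ₗ[A] F} (hf : Function.Surjective f) :
    Function.Surjective (BT.map M f) := by
  intro y
  induction y using BT.induction with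
  | h0 => exact ⟨0, _root_.map_zero _⟩
  | ht m e =>
    obtain ⟨e, rfl⟩ := hf e
    exact ⟨BT.tmul A m e, rfl⟩
  | ha x y hx hy =>
    obtain ⟨x, rfl⟩ := hx
    obtain ⟨y, rfl⟩ := hy
    exact ⟨x + y, map_add _ _ _⟩

/-- Right exactness of `M ⊗_A -`. -/
theorem BT.exact_map_of_surjective {f : E →ₗ[A] F} {g : F →ₗ[A] G} (h : Function.Exact f g)
    (hg : Function.Surjective g) : Function.Exact (BT.map M f) (BT.map M g) := by
  have key : ∀ (m : M) (y y' : F), g y = g y' →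
      (BT.tmul A m y : BT A M F ⧸ (BT.map M f).range) = BT.tmul A m y' := by
    intro m y y' hy
    obtain ⟨e, he⟩ := (h (y - y')).1 (by rw [map_sub, hy, sub_self])
    refine (QuotientAddGroup.eq_iff_sub_mem).2 ⟨BT.tmul A m e, ?_⟩
    rw [BT.map_tmul, he, sub_eq_add_neg, BT.tmul_add, sub_eq_add_neg]
    congr 1
    exact map_neg (AddMonoidHom.mk' (fun e => BT.tmul A m e) (BT.tmul_add A m)) y'
  -- The section `s` is only set-theoretic; by `key` its choice is invisible modulo the image of
  -- `BT.map M f`. So `m ⊗ z ↦ m ⊗ s z` is balanced and biadditive there, and `ψ` is a left inverse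
  -- of the map that `BT.map M g` induces on the cokernel.
  let s := Function.surjInv hg
  have hs : ∀ z, g (s z) = z := Function.surjInv_eq hg
  let ψ : BT A M G →+ BT A M F ⧸ (BT.map M f).range :=
    BT.lift (fun m z => (BT.tmul A m (s z) : BT A M F ⧸ (BT.map M f).range))
      (fun m n z => by rw [BT.add_tmul]; rfl)
      (fun m z z' => by
        rw [key m (s (z + z')) (s z + s z') (by simp only [map_add, hs]), BT.tmul_add]; rfl)
      (fun m a z => by
        rw [BT.smul_tmul]; exact key m _ _ (by rw [hs, LinearMap.map_smul, hs]))
  have hψ : ∀ x, ψ (BT.map M g x) = x := by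
    intro x
    induction x using BT.induction with
    | h0 => rw [_root_.map_zero, _root_.map_zero]; rfl
    | ht m y => exact key m _ _ (hs _)
    | ha x y hx hy => rw [map_add, map_add, hx, hy]; rfl
  intro x
  refine ⟨fun hx => ?_, ?_⟩
  · have h0 := hψ x
    rw [hx, _root_.map_zero] at h0
    exact (QuotientAddGroup.eq_zero_iff x).1 h0.symm
  · rintro ⟨y, rfl⟩
    rw [← BT.map_comp]
    have : g ∘ₗ f = 0 := LinearMap.ext fun e => (h (f e)).2 ⟨e, rfl⟩
    rw [this, BT.map_zero]

/-- Tensoring with a flat right module is exact. -/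
theorem IsFlatRight.exact_map (hM : IsFlatRight A M) {f : E →ₗ[A] F} {g : F →ₗ[A] G}
    (h : Function.Exact f g) : Function.Exact (BT.map M f) (BT.map M g) := by
  -- Factor `g` through its range: right exactness handles the surjection onto the range, flatness
  -- the inclusion of the range.
  have h' : Function.Exact f g.rangeRestrict := fun y =>
    (Subtype.ext_iff (a1 := g.rangeRestrict y) (a2 := 0)).trans (h y)
  intro x
  rw [← BT.exact_map_of_surjective h' g.surjective_rangeRestrict x,
    ← (injective_iff_map_eq_zero' _).1 (hM _ _ (LinearMap.range g).subtype Subtype.val_injective),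
    ← BT.map_comp]
  rfl

end BalancedExactness

namespace ExtAlg

variable {k : Type v} {A : Type u} [CommRing k] [Ring A] [Algebra k A] (X : ExtAlg k A)

/-! ### One-forms are generated by differentials -/

theorem mul_adb_mem_range (a : A) {w : X.Ω} (hw : w ∈ LinearMap.range X.adb) :
    X.ofA a * w ∈ LinearMap.range X.adb := by
  obtain ⟨x, rfl⟩ := hw
  exact ⟨a • x, X.adb_smul a x⟩

/-- Leibniz rule: `(a db) c = a d(bc) - ab dc`. -/
theorem adb_mul_mem_range (a : A) {w : X.Ω} (hw : w ∈ LinearMap.range X.adb) :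
    w * X.ofA a ∈ LinearMap.range X.adb := by
  obtain ⟨x, rfl⟩ := hw
  refine ⟨rmul a x - (LinearMap.mul' k A x) ⊗ₜ a, ?_⟩
  rw [map_sub, adb_rmul, adb_tmul, add_sub_cancel_right]

/-- This is where generation of `Ω` by `A` and `dA` enters. It makes the map from `J¹ A` onto `Ω¹`
surjective. -/
theorem deg_one_le_range_adb : X.deg 1 ≤ LinearMap.range X.adb := by
  classical
  let := X.isInternal.chooseDecomposition
  let : GradedAlgebra X.deg := { X.gradedMonoid with }
  -- The claim is about the degree-one part of an arbitrary element, so that it survives induction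
  -- over products: `(xy)₁ = x₀ y₁ + x₁ y₀`, with `x₀` and `y₀` in `A`.
  have key : ∀ x : X.Ω, (DirectSum.decompose X.deg x 1 : X.Ω) ∈ LinearMap.range X.adb := by
    intro x
    have hx : x ∈ Algebra.adjoin k (Set.range X.ofA ∪ Set.range (fun a => X.d (X.ofA a))) := by
      rw [X.generated]; trivial
    induction hx using Algebra.adjoin_induction with
    | mem x hx =>
      rcases hx with ⟨a, rfl⟩ | ⟨a, rfl⟩
      · rw [DirectSum.decompose_of_mem_ne X.deg (X.ofA_mem a) zero_ne_one]
        exact zero_mem _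
      · rw [DirectSum.decompose_of_mem_same X.deg (X.d_mem 0 _ (X.ofA_mem a))]
        exact ⟨1 ⊗ₜ a, by simp⟩
    | algebraMap r =>
      rw [← X.ofA.commutes, DirectSum.decompose_of_mem_ne X.deg (X.ofA_mem _) zero_ne_one]
      exact zero_mem _
    | add x y _ _ hx hy =>
      rw [DirectSum.decompose_add]
      exact add_mem hx hy
    | mul x y _ _ hx hy =>
      rw [DirectSum.decompose_mul, DirectSum.coe_mul_apply]
      refine Submodule.sum_mem _ fun ij hij => ?_
      obtain ⟨i, j⟩ := ij
      have hij : i + j = 1 := (Finset.mem_filter.1 hij).2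
      have hdeg : ∀ z : X.Ω, ∃ a, X.ofA a = (DirectSum.decompose X.deg z 0 : X.Ω) := fun z =>
        X.range_ofA.ge (DirectSum.decompose X.deg z 0).2
      obtain ⟨rfl, rfl⟩ | ⟨rfl, rfl⟩ : (i = 0 ∧ j = 1) ∨ (i = 1 ∧ j = 0) := by omega
      · obtain ⟨a, ha⟩ := hdeg x
        dsimp only
        rw [← ha]; exact X.mul_adb_mem_range a hy
      · obtain ⟨a, ha⟩ := hdeg y
        dsimp only
        rw [← ha]; exact X.adb_mul_mem_range a hx
  intro x hx
  have := key x
  rwa [DirectSum.decompose_of_mem_same X.deg hx] at this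

/-! ### The splitting of 1-jets -/

theorem dab_jmk_eq (x : A ⊗[k] A) :
    X.dab (X.jmk x) = X.d (X.ofA (LinearMap.mul' k A x)) - X.adb x := by
  induction x using TensorProduct.induction_on with
  | zero => simp
  | tmul a b => simp [leibniz_ofA]
  | add x y hx hy => simp only [map_add, dab_add, hx, hy]; abel

theorem jproj_smul (a : A) (p : X.J1) : X.jproj (a • p) = a * X.jproj p := by
  induction p using J1.induction with
  | h0 => simp
  | ht b c => simp [smul_jmk_tmul, mul_assoc]
  | ha p q hp hq => simp only [smul_add, map_add, hp, hq, mul_add]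

theorem jproj_op_smul (a : A) (p : X.J1) : X.jproj (op a • p) = X.jproj p * a := by
  induction p using J1.induction with
  | h0 => simp
  | ht b c => simp [op_smul_tmul, mul_assoc]
  | ha p q hp hq => simp only [smul_add, map_add, hp, hq, add_mul]

/-- The map `J¹ A → Ω¹`, `[a ⊗ b] ↦ (da) b`, as a map of forms. -/
def dabForm : X.J1 →+ X.Form 1 := X.spencerForm X.oneForm

theorem val_dabForm (p : X.J1) : X.val 1 (X.dabForm p) = X.dab p := rfl

variable {X} in
-- Since `(da) b = d(ab) - a db`, the conditions `∑ ab = 0`, `∑ (da) b = 0` cut out the same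
-- relations as `∑ ab = 0`, `∑ a db = 0`.
theorem J1.ext {p q : X.J1} (h : X.jproj p = X.jproj q) (h' : X.dabForm p = X.dabForm q) :
    p = q := by
  rw [← sub_eq_zero] at h h' ⊢
  rw [← map_sub] at h h'
  generalize p - q = r at *
  obtain ⟨x, rfl⟩ := X.jetRel.mkQ_surjective r
  have h1 : LinearMap.mul' k A x = 0 := h
  have h2 : X.dab (X.jmk x) = 0 := by
    rw [← val_dabForm]; exact (congrArg _ h').trans (map_zero _)
  rw [dab_jmk_eq, h1, map_zero, map_zero, zero_sub, neg_eq_zero] at h2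
  exact (Submodule.Quotient.mk_eq_zero _).2 ⟨h1, h2⟩

theorem exists_jproj_eq_zero_dabForm_eq (ω : X.Form 1) :
    ∃ p : X.J1, X.jproj p = 0 ∧ X.dabForm p = ω := by
  obtain ⟨x, hx⟩ := X.deg_one_le_range_adb (val_mem ω)
  -- For `ω = ∑ a db` the witness is `∑ [ab ⊗ 1 - a ⊗ b]`, because `d(ab) - (da) b = a db`.
  refine ⟨X.jmk ((LinearMap.mul' k A x) ⊗ₜ 1 - x), ?_, val_injective ?_⟩
  · rw [map_sub, map_sub, jproj_jmk, mul_one]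
    exact sub_self _
  · rw [val_dabForm, dab_jmk_eq]
    simp [hx, d_one]

/-- The section `Ω¹ → J¹ A` of `[a ⊗ b] ↦ (da) b` with values in the kernel of the product. -/
def formJ1 (ω : X.Form 1) : X.J1 := (X.exists_jproj_eq_zero_dabForm_eq ω).choose

@[simp] theorem jproj_formJ1 (ω : X.Form 1) : X.jproj (X.formJ1 ω) = 0 :=
  (X.exists_jproj_eq_zero_dabForm_eq ω).choose_spec.1

@[simp] theorem dabForm_formJ1 (ω : X.Form 1) : X.dabForm (X.formJ1 ω) = ω :=
  (X.exists_jproj_eq_zero_dabForm_eq ω).choose_spec.2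

/-- On the left `dabForm` is only a first-order operator, and the error term contains `jproj p`. It
is therefore left linear on the kernel of the product, which is why `formJet` is `A`-linear although
`jetDiff` is merely additive. -/
theorem dabForm_smul (a : A) (p : X.J1) :
    X.dabForm (a • p) = a • X.dabForm p + op (X.jproj p) • X.dA a :=
  val_injective (by
    rw [map_add, val_dabForm, val_smul, val_op_smul, val_dA, val_dabForm, dab_smul, unop_op])

theorem dabForm_op_smul (a : A) (p : X.J1) : X.dabForm (op a • p) = op a • X.dabForm p :=
  val_injective (by rw [val_dabForm, val_op_smul, val_dabForm, dab_op_smul, unop_op])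

section OneJets

variable (F : Type u) [AddCommGroup F] [Module A F]

/-- The projection `J¹ F → F`, `[a ⊗ b] ⊗ f ↦ a b f`. -/
def jetProj : BT A X.J1 F →ₗ[A] F where
  toFun := BT.lift (fun p f => X.jproj p • f) (fun _ _ _ => by rw [map_add, add_smul])
    (fun _ _ _ => smul_add _ _ _) (fun p a f => by rw [jproj_op_smul, mul_smul])
  map_add' := map_add _
  map_smul' a x := by
    induction x using BT.induction with
    | h0 => simp
    | ht p f => simp [BT.smul_def, jproj_smul, mul_smul]
    | ha x y hx hy => simp only [smul_add, map_add, hx, hy]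

@[simp] theorem jetProj_tmul (p : X.J1) (f : F) :
    X.jetProj F (BT.tmul A p f) = X.jproj p • f := rfl

/-- The operator `J¹ F → Ω¹ F`, `[a ⊗ b] ⊗ f ↦ (da) b ⊗ f`. -/
def jetDiff : BT A X.J1 F →+ BT A (X.Form 1) F :=
  BT.lift (fun p f => BT.tmul A (X.dabForm p) f)
    (fun _ _ _ => by rw [map_add, BT.add_tmul]) (fun _ _ _ => BT.tmul_add A _ _ _)
    (fun p a f => by rw [dabForm_op_smul, BT.smul_tmul])

@[simp] theorem jetDiff_tmul (p : X.J1) (f : F) :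
    X.jetDiff F (BT.tmul A p f) = BT.tmul A (X.dabForm p) f := rfl

/-- The inclusion `Ω¹ F → J¹ F` of the kernel of the projection `J¹ F → F`. -/
def formJet : BT A (X.Form 1) F →ₗ[A] BT A X.J1 F where
  toFun := BT.lift (fun ω f => BT.tmul A (X.formJ1 ω) f)
    (fun ω η f => by
      -- `formJ1` is given by choice; its additivity and bilinearity come from uniqueness, that is,
      -- from `J1.ext`.
      rw [← BT.add_tmul]; congr 1; exact J1.ext (by simp) (by simp))
    (fun _ _ _ => BT.tmul_add A _ _ _)
    (fun ω a f => by
      rw [← BT.smul_tmul]; congr 1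
      exact J1.ext (by simp [jproj_op_smul]) (by simp [dabForm_op_smul]))
  map_add' := map_add _
  map_smul' a x := by
    induction x using BT.induction with
    | h0 => simp
    | ht ω f =>
      simp only [BT.smul_def, BT.lift_tmul, RingHom.id_apply]; congr 1
      exact J1.ext (by simp [jproj_smul]) (by simp [dabForm_smul])
    | ha x y hx hy => simp only [smul_add, map_add, hx, hy]

@[simp] theorem formJet_tmul (ω : X.Form 1) (f : F) :
    X.formJet F (BT.tmul A ω f) = BT.tmul A (X.formJ1 ω) f := rfl

@[simp] theorem jetProj_formJet (θ : BT A (X.Form 1) F) : X.jetProj F (X.formJet F θ) = 0 := by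
  induction θ using BT.induction with
  | h0 => simp
  | ht ω f => simp
  | ha x y hx hy => simp only [map_add, hx, hy, add_zero]

@[simp] theorem jetDiff_formJet (θ : BT A (X.Form 1) F) : X.jetDiff F (X.formJet F θ) = θ := by
  induction θ using BT.induction with
  | h0 => simp
  | ht ω f => simp
  | ha x y hx hy => simp only [map_add, hx, hy]

@[simp] theorem jetProj_prolongOne (f : F) : X.jetProj F (X.prolongOne f) = f := by
  change X.jproj (X.jmk (1 ⊗ₜ 1)) • f = f
  simp

theorem dabForm_one : X.dabForm (X.jmk (1 ⊗ₜ 1)) = 0 :=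
  val_injective (by simp [val_dabForm, d_one])

@[simp] theorem jetDiff_prolongOne (f : F) : X.jetDiff F (X.prolongOne f) = 0 := by
  change BT.tmul A (X.dabForm (X.jmk (1 ⊗ₜ 1))) f = 0
  rw [dabForm_one, BT.zero_tmul]

/-- The additive splitting `J¹ F = F ⊕ Ω¹ F`. It reduces to `[a ⊗ b] = [1 ⊗ ab] + formJ1 ((da) b)`,
where both sides have the same product and the same image in `Ω¹`. -/
theorem prolongOne_add_formJet (ξ : BT A X.J1 F) :
    X.prolongOne (X.jetProj F ξ) + X.formJet F (X.jetDiff F ξ) = ξ := by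
  induction ξ using BT.induction with
  | h0 => simp
  | ht p f =>
    rw [jetProj_tmul, jetDiff_tmul, formJet_tmul]
    change BT.tmul A (X.jmk (1 ⊗ₜ 1)) (X.jproj p • f) + _ = _
    rw [← BT.smul_tmul, ← BT.add_tmul]; congr 1
    exact J1.ext (by simp [jproj_op_smul]) (by simp [dabForm_op_smul, dabForm_one])
  | ha x y hx hy =>
    nth_rw 3 [← hx, ← hy]
    simp only [map_add]; abel

variable {F} in
theorem oneJet_ext {ξ ζ : BT A X.J1 F} (h : X.jetProj F ξ = X.jetProj F ζ)
    (h' : X.jetDiff F ξ = X.jetDiff F ζ) : ξ = ζ := by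
  rw [← X.prolongOne_add_formJet F ξ, h, h', prolongOne_add_formJet]

section Naturality

variable {F} {G : Type u} [AddCommGroup G] [Module A G] (f : F →ₗ[A] G)

theorem jetProj_map (x : BT A X.J1 F) : X.jetProj G (BT.map X.J1 f x) = f (X.jetProj F x) := by
  induction x using BT.induction with
  | h0 => simp
  | ht p e => simp
  | ha x y hx hy => simp only [map_add, hx, hy]

theorem jetDiff_map (x : BT A X.J1 F) :
    X.jetDiff G (BT.map X.J1 f x) = BT.map (X.Form 1) f (X.jetDiff F x) := by
  induction x using BT.induction with
  | h0 => simp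
  | ht p e => simp
  | ha x y hx hy => simp only [map_add, hx, hy]

/-- The argument `g` is `Ω^q f` as an `A`-linear map, needed to apply `Ωᵖ` to it; `BT.map` by itself
is only additive. -/
theorem wedge_map (p q : ℕ) (x : BT A (X.Form p) (BT A (X.Form q) F))
    (g : BT A (X.Form q) F →ₗ[A] BT A (X.Form q) G) (hg : ∀ y, g y = BT.map (X.Form q) f y) :
    X.wedge G p q (BT.map (X.Form p) g x) = BT.map (X.Form (p + q)) f (X.wedge F p q x) := by
  induction x using BT.induction with
  | h0 => simp
  | ha x y hx hy => simp only [map_add, hx, hy]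
  | ht ω y =>
    rw [BT.map_tmul, hg]
    induction y using BT.induction with
    | h0 => simp [BT.tmul_zero]
    | ha x y hx hy => simp only [BT.tmul_add, map_add, hx, hy]
    | ht p f => rfl

end Naturality

/-! ### The Spencer operator and the holonomy conditions in terms of the splitting -/

theorem spencerForm_eq {m : ℕ} (ω : X.Form m) (p : X.J1) :
    X.spencerForm ω p =
      op (X.jproj p) • X.dForm ω + (-1 : ℤ) ^ m • X.mulForm ω (X.dabForm p) := by
  refine val_injective ?_
  rw [map_add, map_zsmul, val_op_smul, val_mulForm, val_dabForm, zsmul_eq_mul]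
  push_cast
  change _ = X.d (X.val m ω) * _ + _
  induction p using J1.induction with
  | h0 => simp
  | ht a b =>
    rw [val_spencerForm, X.leibniz m _ (val_mem ω), dab_jmk, jproj_jmk, unop_op, map_mul]
    noncomm_ring
  | ha p q hp hq =>
    simp only [map_add, dab_add, unop_op] at *
    rw [hp, hq]; noncomm_ring

/-- Leibniz rule: `d(ωa) b = dω ab + (-1)ᵐ ω ∧ (da) b`. Here `ω` is kept fixed because `ω ↦ dω` is
not right `A`-linear, so the two summands are not separately defined on `Ωᵐ J¹ F`. -/
theorem spencerOne_tmul_eq (m : ℕ) (ω : X.Form m) (ξ : BT A X.J1 F) :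
    X.spencerOne F m (BT.tmul A ω ξ) = BT.tmul A (X.dForm ω) (X.jetProj F ξ) +
      (-1 : ℤ) ^ m • X.wedge F m 1 (BT.tmul A ω (X.jetDiff F ξ)) := by
  induction ξ using BT.induction with
  | h0 => simp [BT.tmul_zero]
  | ha x y hx hy => simp only [BT.tmul_add, map_add, smul_add, hx, hy]; abel
  | ht p f =>
    rw [spencerOne_tmul, spencerForm_eq, BT.add_tmul, BT.smul_tmul]
    refine congrArg₂ _ rfl ?_
    exact map_zsmul (AddMonoidHom.mk' (fun w : X.Form (m + 1) => BT.tmul A w f)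
      (fun _ _ => BT.add_tmul A _ _ _)) _ _

/-- On `Ω¹ F ⊆ J¹ F` the projection vanishes, so the term with `dω` disappears and only the signed
wedge product remains. This is the source of `δ` inside the Spencer operator. -/
theorem spencerOne_map_formJet {G : Type u} [AddCommGroup G] [Module A G]
    (f : G →ₗ[A] BT A (X.Form 1) F) (m : ℕ) (x : BT A (X.Form m) G) :
    X.spencerOne F m (BT.map (X.Form m) (X.formJet F ∘ₗ f) x) =
      (-1 : ℤ) ^ m • X.wedge F m 1 (BT.map (X.Form m) f x) := by
  induction x using BT.induction with
  | h0 => simp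
  | ha x y hx hy => simp only [map_add, smul_add, hx, hy]
  | ht ω y => simp [spencerOne_tmul_eq, BT.tmul_zero]

theorem formDI_eq (p q : X.J1) :
    X.formDI q p = X.dabForm (X.jproj p • q) - op (X.jproj q) • X.dabForm p := by
  refine val_injective ?_
  rw [map_sub, val_op_smul, val_dabForm, val_dabForm, dab_smul, unop_op]
  induction p using J1.induction with
  | h0 => simp
  | ht a b => simp [val_formDI, dab_smul, leibniz_ofA, mul_add, add_mul, mul_assoc]; abel
  | ha p p' hp hp' => simp only [map_add, dab_add, hp, hp']; noncomm_ring

theorem formDII_eq (p q : X.J1) : X.formDII q p = -X.spencerForm (X.dabForm p) q := by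
  refine val_injective ?_
  rw [map_neg]
  induction p using J1.induction with
  | h0 => simp [spencerForm_zero]
  | ha p p' hp hp' => simp only [map_add, spencerForm_add, hp, hp']; abel
  | ht a b =>
    induction q using J1.induction with
    | h0 => simp [formDII_zero]
    | ha q q' hq hq' => simp only [map_add, formDII_add, hq, hq']; abel
    | ht c f =>
      rw [val_formDII, val_spencerForm, val_dabForm, smul_jmk_tmul, dab_jmk, dab_jmk, mul_assoc,
        ← map_mul, X.leibniz 1 _ (X.d_mem 0 _ (X.ofA_mem a)), X.d_d]
      noncomm_ring

/-- On generators, `a d(bc) f = d(abcf-type product)` is not needed: two Leibniz expansions give `a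
d(bc) f = d(abc) f - (da) bcf`, which are the two terms. -/
theorem DI_eq (y : BT A X.J1 (BT A X.J1 F)) :
    X.DI F y = X.jetDiff F (X.jetProj (BT A X.J1 F) y) -
      BT.map (X.Form 1) (X.jetProj F) (X.jetDiff (BT A X.J1 F) y) := by
  induction y using BT.induction with
  | h0 => simp
  | ha x y hx hy => simp only [map_add, hx, hy]; abel
  | ht p y =>
    induction y using BT.induction with
    | h0 => simp [BT.tmul_zero]
    | ha x y hx hy => simp only [BT.tmul_add, map_add, hx, hy]; abel
    | ht q e =>
      rw [DI_tmul, jetProj_tmul, jetDiff_tmul, BT.map_tmul, BT.smul_def, jetDiff_tmul, jetProj_tmul,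
        formDI_eq, ← BT.smul_tmul]
      exact map_sub (AddMonoidHom.mk' (fun w : X.Form 1 => BT.tmul A w e)
        (fun _ _ => BT.add_tmul A _ _ _)) _ _

/-- On generators, `d((da) b c) f = -da ∧ d(bc) f`, because `d² = 0` and `da` has degree one. -/
theorem DII_eq (y : BT A X.J1 (BT A X.J1 F)) :
    X.DII F y = -X.spencerOne F 1 (X.jetDiff (BT A X.J1 F) y) := by
  induction y using BT.induction with
  | h0 => simp
  | ha x y hx hy => simp only [map_add, hx, hy]; abel
  | ht p y =>
    induction y using BT.induction with
    | h0 => simp [BT.tmul_zero]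
    | ha x y hx hy => simp only [BT.tmul_add, map_add, hx, hy]; abel
    | ht q e =>
      rw [DII_tmul, jetDiff_tmul, spencerOne_tmul, formDII_eq]
      exact map_neg (AddMonoidHom.mk' (fun w : X.Form 2 => BT.tmul A w e)
        (fun _ _ => BT.add_tmul A _ _ _)) _

end OneJets

variable (E : Type u) [AddCommGroup E] [Module A E]

/-! ### The projections between holonomic jets -/

/-- The projection `Jⁿ⁺¹ E → Jⁿ E`. -/
def holProj (n : ℕ) : X.Jet E (n + 1) →ₗ[A] X.Jet E n := X.jetProj (X.Jet E n) ∘ₗ X.jetIncl E n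

/-- The operator `Jⁿ⁺¹ E → Ω¹ Jⁿ E`, the Spencer operator in form degree zero. -/
def holDiff (n : ℕ) : X.Jet E (n + 1) →+ BT A (X.Form 1) (X.Jet E n) :=
  (X.jetDiff (X.Jet E n)).comp (X.jetIncl E n).toAddMonoidHom

theorem jetIncl_injective : ∀ n, Function.Injective (X.jetIncl E n)
  | 0 => fun _ _ h => h
  | _ + 1 => Subtype.val_injective

theorem holProj_prolong (n : ℕ) (e : E) :
    X.holProj E n (X.prolong E (n + 1) e) = X.prolong E n e :=
  (congrArg (X.jetProj _) (X.jetIncl_prolong E n e)).trans (X.jetProj_prolongOne _ _)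

theorem spencer_tmul (n m : ℕ) (ω : X.Form m) (ξ : X.Jet E (n + 1)) :
    X.spencer E n m (BT.tmul A ω ξ) = BT.tmul A (X.dForm ω) (X.holProj E n ξ) +
      (-1 : ℤ) ^ m • X.wedge (X.Jet E n) m 1 (BT.tmul A ω (X.holDiff E n ξ)) :=
  X.spencerOne_tmul_eq _ m ω _

/-- The map `Ωᵐ f`, which is `A`-linear for `A`-linear `f`. -/
def formMap {F G : Type u} [AddCommGroup F] [Module A F] [AddCommGroup G] [Module A G]
    (m : ℕ) (f : F →ₗ[A] G) : BT A (X.Form m) F →ₗ[A] BT A (X.Form m) G where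
  toFun := BT.map (X.Form m) f
  map_add' := map_add _
  map_smul' := BT.map_smul A f

theorem DI_map_jetIncl (n : ℕ) (x : BT A X.J1 (X.Jet E (n + 1))) :
    X.DI (X.Jet E n) (BT.map X.J1 (X.jetIncl E n) x) =
      X.holDiff E n (X.jetProj _ x) - BT.map (X.Form 1) (X.holProj E n) (X.jetDiff _ x) := by
  rw [DI_eq, jetProj_map, jetDiff_map, ← BT.map_comp]
  rfl

theorem DII_map_jetIncl (n : ℕ) (x : BT A X.J1 (X.Jet E (n + 1))) :
    X.DII (X.Jet E n) (BT.map X.J1 (X.jetIncl E n) x) = -X.spencer E n 1 (X.jetDiff _ x) := by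
  rw [DII_eq, jetDiff_map]
  rfl

theorem holDiff_holProj (n : ℕ) (ξ : X.Jet E (n + 2)) :
    X.holDiff E n (X.holProj E (n + 1) ξ) =
      BT.map (X.Form 1) (X.holProj E n) (X.holDiff E (n + 1) ξ) := by
  have h := X.jetIncl_DI E n ξ
  rwa [DI_map_jetIncl, sub_eq_zero] at h

theorem spencer_holDiff (n : ℕ) (ξ : X.Jet E (n + 2)) :
    X.spencer E n 1 (X.holDiff E (n + 1) ξ) = 0 := by
  have h := X.jetIncl_DII E n ξ
  rwa [DII_map_jetIncl, neg_eq_zero] at h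

variable {E} in
/-- The 1-jets of `Jⁿ⁺¹ E` that satisfy the holonomy conditions. -/
theorem mem_jetStage_ker {n : ℕ} (x : BT A X.J1 (X.Jet E (n + 1)))
    (h₁ : X.holDiff E n (X.jetProj _ x) = BT.map (X.Form 1) (X.holProj E n) (X.jetDiff _ x))
    (h₂ : X.spencer E n 1 (X.jetDiff _ x) = 0) : x ∈ (X.jetStage E n).ker :=
  ⟨(X.DI_map_jetIncl E n x).trans (sub_eq_zero.2 h₁),
    (X.DII_map_jetIncl E n x).trans (neg_eq_zero.2 h₂)⟩

/-- The first holonomy condition, in the form `holDiff_holProj`, is what makes the jet projections a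
morphism of Spencer complexes. -/
theorem map_holProj_spencer (n m : ℕ) (x : BT A (X.Form m) (X.Jet E (n + 2))) :
    BT.map (X.Form (m + 1)) (X.holProj E n) (X.spencer E (n + 1) m x) =
      X.spencer E n m (BT.map (X.Form m) (X.holProj E (n + 1)) x) := by
  induction x using BT.induction with
  | h0 => simp
  | ha x y hx hy => simp only [map_add, hx, hy]
  | ht ω ξ =>
    rw [BT.map_tmul, spencer_tmul, spencer_tmul, map_add, map_zsmul, BT.map_tmul, holDiff_holProj,
      ← X.wedge_map (X.holProj E n) m 1 _ (X.formMap 1 (X.holProj E n)) (fun _ => rfl)]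
    rfl

/-! ### The inclusion of symmetric forms in holonomic jets -/

/-- Stated for any compatible pair `f`, `g`, since it is used while the inclusions `Sⁿ E → Jⁿ E` are
still being constructed recursively. -/
theorem spencer_map_of_jetIncl_eq {n : ℕ} (f : X.Sym E n →ₗ[A] X.Jet E n)
    (g : X.Sym E (n + 1) →ₗ[A] X.Jet E (n + 1))
    (h : ∀ s, X.jetIncl E n (g s) = X.formJet _ (BT.map (X.Form 1) f (X.symIncl E n s)))
    (m : ℕ) (x : BT A (X.Form m) (X.Sym E (n + 1))) :
    X.spencer E n m (BT.map (X.Form m) g x) = BT.map (X.Form (m + 1)) f (X.delta E n m x) := by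
  have hg : X.jetIncl E n ∘ₗ g = X.formJet _ ∘ₗ (X.formMap 1 f ∘ₗ X.symIncl E n) :=
    LinearMap.ext h
  change X.spencerOne _ m (BT.map _ (X.jetIncl E n) (BT.map _ g x)) = _
  rw [← BT.map_comp, hg, spencerOne_map_formJet, BT.map_comp,
    X.wedge_map f m 1 _ (X.formMap 1 f) (fun _ => rfl), ← map_zsmul]
  rfl

/-- Both sides of the first holonomy condition vanish because the projections do; the second
condition becomes the wedge condition that defines `Sⁿ⁺² E`. -/
theorem formJet_map_mem_ker {n : ℕ} (f : X.Sym E n →ₗ[A] X.Jet E n)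
    (g : X.Sym E (n + 1) →ₗ[A] X.Jet E (n + 1))
    (h : ∀ s, X.jetIncl E n (g s) = X.formJet _ (BT.map (X.Form 1) f (X.symIncl E n s)))
    (s : X.Sym E (n + 2)) :
    X.formJet _ (BT.map (X.Form 1) g (X.symIncl E (n + 1) s)) ∈ (X.jetStage E n).ker := by
  refine X.mem_jetStage_ker _ ?_ ?_
  · have hg : X.holProj E n ∘ₗ g = 0 :=
      LinearMap.ext fun s => (congrArg (X.jetProj _) (h s)).trans (X.jetProj_formJet _ _)
    rw [jetProj_formJet, jetDiff_formJet, ← BT.map_comp, hg, BT.map_zero, map_zero]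
  · rw [jetDiff_formJet, X.spencer_map_of_jetIncl_eq E f g h, delta, AddMonoidHom.smul_apply,
      AddMonoidHom.comp_apply, symIncl_wedge, smul_zero, map_zero]

/-- The inclusions `Sⁿ E → Jⁿ E` and `Sⁿ⁺¹ E → Jⁿ⁺¹ E`, where the second one is the corestriction
of `Sⁿ⁺¹ E → Ω¹ Sⁿ E → Ω¹ Jⁿ E → J¹ Jⁿ E`. -/
def symJetPair : (n : ℕ) →
    {p : (X.Sym E n →ₗ[A] X.Jet E n) × (X.Sym E (n + 1) →ₗ[A] X.Jet E (n + 1)) //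
      ∀ s, X.jetIncl E n (p.2 s) = X.formJet _ (BT.map (X.Form 1) p.1 (X.symIncl E n s))}
  | 0 => ⟨(LinearMap.id, X.formJet E), fun s =>
      congrArg (X.formJet E) (BT.map_id (M := X.Form 1) (E := E) s).symm⟩
  | n + 1 =>
    let p := symJetPair n
    ⟨(p.1.2, LinearMap.codRestrict (X.jetStage E n).ker
      (X.formJet (X.Jet E (n + 1)) ∘ₗ X.formMap 1 p.1.2 ∘ₗ X.symIncl E (n + 1))
      (X.formJet_map_mem_ker E p.1.1 p.1.2 p.2)), fun _ => rfl⟩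

/-- The inclusion `Sⁿ E → Jⁿ E`. -/
def symJet (n : ℕ) : X.Sym E n →ₗ[A] X.Jet E n := (X.symJetPair E n).1.1

theorem jetIncl_symJet (n : ℕ) (s : X.Sym E (n + 1)) : X.jetIncl E n (X.symJet E (n + 1) s) =
    X.formJet _ (BT.map (X.Form 1) (X.symJet E n) (X.symIncl E n s)) :=
  (X.symJetPair E n).2 s

theorem holProj_symJet (n : ℕ) (s : X.Sym E (n + 1)) :
    X.holProj E n (X.symJet E (n + 1) s) = 0 :=
  (congrArg (X.jetProj _) (X.jetIncl_symJet E n s)).trans (X.jetProj_formJet _ _)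

theorem spencer_map_symJet (n m : ℕ) (x : BT A (X.Form m) (X.Sym E (n + 1))) :
    X.spencer E n m (BT.map (X.Form m) (X.symJet E (n + 1)) x) =
      BT.map (X.Form (m + 1)) (X.symJet E n) (X.delta E n m x) :=
  X.spencer_map_of_jetIncl_eq E _ _ (X.jetIncl_symJet E n) m x

theorem map_symJet_zero (m : ℕ) (x : BT A (X.Form m) E) :
    BT.map (X.Form m) (X.symJet E 0) x = x :=
  BT.map_id x

theorem symIncl_injective : ∀ n, Function.Injective (X.symIncl E n)
  | 0 => fun _ _ h => h
  | _ + 1 => Subtype.val_injective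

/-! ### Symmetric forms as the kernel of the jet projections -/

variable {X}

/-- `jetDiff` undoes `formJet`, which leaves `Ω¹` applied to the previous inclusion; flatness of
`Ω¹` keeps that injective. -/
theorem symJet_injective (hflat : X.IsFlat) : ∀ n, Function.Injective (X.symJet E n)
  | 0 => fun _ _ h => h
  | n + 1 => by
    intro s t h
    have h' := congrArg (X.jetDiff _ ∘ X.jetIncl E n) h
    simp only [Function.comp_apply, jetIncl_symJet, jetDiff_formJet] at h'
    exact X.symIncl_injective E n (hflat 1 _ _ _ (symJet_injective hflat n) h')

theorem map_symJet_injective (hflat : X.IsFlat) (n m : ℕ) :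
    Function.Injective (BT.map (X.Form m) (X.symJet E n)) :=
  hflat m _ _ _ (symJet_injective E hflat n)

theorem jetIncl_eq_formJet {n : ℕ} {ξ : X.Jet E (n + 1)} (h : X.holProj E n ξ = 0) :
    X.jetIncl E n ξ = X.formJet _ (X.holDiff E n ξ) := by
  refine X.oneJet_ext ?_ (X.jetDiff_formJet _ _).symm
  rw [jetProj_formJet]
  exact h

theorem symJet_eq {n : ℕ} {ξ : X.Jet E (n + 1)} (h : X.holProj E n ξ = 0) (s : X.Sym E (n + 1))
    (hs : BT.map (X.Form 1) (X.symJet E n) (X.symIncl E n s) = X.holDiff E n ξ) :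
    X.symJet E (n + 1) s = ξ :=
  X.jetIncl_injective E n (by rw [jetIncl_symJet, jetIncl_eq_formJet E h, hs])

/-- A jet `ξ` with zero projection is determined by `D ξ` in `Ω¹ Jⁿ⁺¹ E`. The first holonomy
condition says that `D ξ` projects to zero in `Ω¹ Jⁿ E`, so by induction and flatness of `Ω¹` it
comes from some `y` in `Ω¹ Sⁿ⁺¹ E`. The second condition becomes `δ y = 0` by flatness of `Ω²`, so
`y` lies in `Sⁿ⁺² E`. -/
theorem exact_symJet_holProj (hflat : X.IsFlat) :
    ∀ n, Function.Exact (X.symJet E (n + 1)) (X.holProj E n) := by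
  intro n
  induction n with
  | zero =>
    refine fun ξ => ⟨fun h => ⟨X.holDiff E 0 ξ, symJet_eq E h _ (X.map_symJet_zero E 1 _)⟩, ?_⟩
    · rintro ⟨s, rfl⟩
      exact X.holProj_symJet E 0 s
  | succ n ih =>
    refine fun ξ => ⟨fun h => ?_, ?_⟩
    · have h₁ := X.holDiff_holProj E n ξ
      rw [h, map_zero] at h₁
      obtain ⟨y, hy⟩ := ((hflat 1).exact_map ih _).1 h₁.symm
      have h₂ := X.spencer_holDiff E n ξ
      rw [← hy, spencer_map_symJet,
        (injective_iff_map_eq_zero' _).1 (map_symJet_injective E hflat n 2)] at h₂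
      -- `δ` on one-forms is minus the wedge map whose kernel defines `Sⁿ⁺² E`.
      have h₃ : y ∈ (X.symStage E n).ker := by
        rw [delta, AddMonoidHom.smul_apply, pow_one, neg_smul, one_smul, neg_eq_zero] at h₂
        exact h₂
      exact ⟨(⟨y, h₃⟩ : (X.symStage E n).ker), symJet_eq E h _ hy⟩
    · rintro ⟨s, rfl⟩
      exact X.holProj_symJet E (n + 1) s

theorem exact_map_symJet_map_holProj (hflat : X.IsFlat) (n m : ℕ) :
    Function.Exact (BT.map (X.Form m) (X.symJet E (n + 1)))
      (BT.map (X.Form m) (X.holProj E n)) :=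
  (hflat m).exact_map (exact_symJet_holProj E hflat n)

theorem deltaKer_le_deltaIm {n m : ℕ} (h : Subsingleton (X.DeltaCohomology E n m)) :
    X.deltaKer E n m ≤ X.deltaIm E n m := by
  rwa [QuotientAddGroup.subsingleton_iff, AddSubgroup.addSubgroupOf_eq_top] at h

/-- Since `Ω⁰ = A`, each `ω ⊗ e` equals `1 ⊗ a e`. This settles bidegree `(0, 0)`, which the
hypothesis on `δ`-cohomology leaves out. -/
theorem augment_zero_surjective : Function.Surjective (X.augment E 0) := by
  intro x
  induction x using BT.induction with
  | h0 => exact ⟨0, map_zero _⟩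
  | ha x y hx hy =>
    obtain ⟨x, rfl⟩ := hx
    obtain ⟨y, rfl⟩ := hy
    exact ⟨x + y, map_add _ _ _⟩
  | ht ω e =>
    obtain ⟨a, ha⟩ : X.val 0 ω ∈ LinearMap.range X.ofA.toLinearMap := by
      rw [X.range_ofA]; exact val_mem ω
    have hω : ω = op a • X.oneForm :=
      val_injective (ha.symm.trans (one_mul (X.ofA a)).symm)
    refine ⟨(a • e : X.Jet E 0), ?_⟩
    rw [hω, BT.smul_tmul]
    rfl

/-! ### Consequences of the vanishing of the `δ`-cohomology -/

section Acyclic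

variable (hflat : X.IsFlat)
  (hδ : ∀ n m : ℕ, (n, m) ≠ (0, 0) → X.deltaKer E n m ≤ X.deltaIm E n m)

include hflat hδ

/-- Obstruction argument. By induction `D η` lifts to some `θ` in `Ω¹ Jⁿ⁺¹ E`, and `(η, θ)` then
satisfies the first holonomy condition. The defect in the second is the Spencer image of `θ`, a
`δ`-cocycle in `Ω² Sⁿ E`. As `H_δ^{n,2}(E) = 0`, it is `δ w` with `w` in `Ω¹ Sⁿ⁺¹ E`, and replacing
`θ` by `θ - w` removes it without changing the projection. -/
theorem holProj_surjective (n : ℕ) : Function.Surjective (X.holProj E n) := by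
  induction n with
  | zero => exact fun e => ⟨X.prolong E 1 e, X.holProj_prolong E 0 e⟩
  | succ n ih =>
    intro η
    obtain ⟨θ, hθ⟩ := BT.map_surjective (M := X.Form 1) ih (X.holDiff E n η)
    obtain ⟨v, hv, hvker⟩ : ∃ v, BT.map (X.Form 2) (X.symJet E n) v = X.spencer E n 1 θ ∧
        v ∈ X.deltaKer E n 2 := by
      cases n with
      -- At `n = 0` there is no lower jet module: `S⁰ E = J⁰ E = E`, and every element of `Ω² E` is
      -- a cocycle.
      | zero => exact ⟨X.spencer E 0 1 θ, X.map_symJet_zero E 2 _, trivial⟩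
      | succ n =>
        have h := X.map_holProj_spencer E n 1 θ
        rw [hθ, spencer_holDiff] at h
        obtain ⟨v, hv⟩ := (exact_map_symJet_map_holProj E hflat n 2 _).1 h
        refine ⟨v, hv, map_symJet_injective E hflat n 3 ?_⟩
        -- The cocycle condition is tested in `Ω³ Jⁿ E`, where `δ` becomes the Spencer operator and
        -- squares to zero.
        rw [map_zero]
        exact (X.spencer_map_symJet E n 2 v).symm.trans
          ((congrArg _ hv).trans (X.spencer_spencer E n 1 θ))
    obtain ⟨w, rfl⟩ := hδ n 2 (by simp) hvker
    let x := X.prolongOne η +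
      X.formJet _ (θ - BT.map (X.Form 1) (X.symJet E (n + 1)) w)
    have hp : X.jetProj _ x = η := by
      rw [map_add, jetProj_prolongOne, jetProj_formJet, add_zero]
    have hd : X.jetDiff _ x = θ - BT.map (X.Form 1) (X.symJet E (n + 1)) w := by
      rw [map_add, jetDiff_prolongOne, jetDiff_formJet, zero_add]
    have hx : x ∈ (X.jetStage E n).ker := by
      refine X.mem_jetStage_ker x ?_ ?_
      · rw [hp, hd, map_sub, hθ,
          (exact_map_symJet_map_holProj E hflat n 1).apply_apply_eq_zero, sub_zero]
      · rw [hd, map_sub, spencer_map_symJet, hv, sub_self]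
    exact ⟨(⟨x, hx⟩ : (X.jetStage E n).ker), hp⟩

theorem map_holProj_surjective (n m : ℕ) :
    Function.Surjective (BT.map (X.Form m) (X.holProj E n)) :=
  BT.map_surjective (holProj_surjective E hflat hδ n)

/-- The chase in the short exact sequence of complexes `Ωᵐ Sⁿ⁺¹ E → Ωᵐ Jⁿ⁺¹ E → Ωᵐ Jⁿ E`. Induction
runs on the jet order for all form degrees at once, since the projection lowers `n` and keeps `m`.
-/
theorem spencerKer_le_spencerIm (n : ℕ) : ∀ m, X.spencerKer E n m ≤ X.spencerIm E n m := by
  induction n with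
  | zero =>
    rintro (_ | m) x -
    · exact augment_zero_surjective E x
    -- At the right end everything is a cocycle for both complexes, and `δ` already maps onto `Ωᵐ⁺¹
    -- E`.
    · obtain ⟨w, hw⟩ := hδ 0 (m + 1) (by simp) (AddSubgroup.mem_top x)
      refine ⟨BT.map (X.Form m) (X.symJet E 1) w, ?_⟩
      rw [spencer_map_symJet, hw]
      exact BT.map_id (E := X.Jet E 0) x
  | succ n ih =>
    intro m x hx
    have hx : X.spencer E n m x = 0 := hx
    have mem_ker : BT.map (X.Form m) (X.holProj E n) x ∈ X.spencerKer E n m := by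
      cases n with
      | zero => trivial
      | succ n =>
        refine (X.map_holProj_spencer E n m x).symm.trans ?_
        rw [hx, map_zero]
    -- A Spencer cocycle with zero projection comes from a `δ`-cocycle, hence from a `δ`-coboundary.
    have lift : ∀ z : BT A (X.Form m) (X.Jet E (n + 1)), X.spencer E n m z = 0 →
        BT.map (X.Form m) (X.holProj E n) z = 0 →
        ∃ w ∈ X.deltaIm E (n + 1) m, BT.map (X.Form m) (X.symJet E (n + 1)) w = z := by
      intro z hz hz'
      obtain ⟨w, rfl⟩ := (exact_map_symJet_map_holProj E hflat n m _).1 hz'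
      refine ⟨w, hδ (n + 1) m (by simp) (map_symJet_injective E hflat n (m + 1) ?_), rfl⟩
      rw [map_zero, ← spencer_map_symJet, hz]
    cases m with
    | zero =>
      obtain ⟨e, he⟩ := ih 0 mem_ker
      refine ⟨e, ?_⟩
      obtain ⟨w, hw, hwz⟩ := lift (x - X.augment E (n + 1) e)
        (by rw [map_sub, hx, spencer_augment, sub_zero])
        (by
          rw [map_sub, ← he, sub_eq_zero]
          exact congrArg (BT.tmul A X.oneForm) (X.holProj_prolong E n e).symm)
      -- In form degree zero the `δ`-coboundaries are zero, so the element `e` found one order lower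
      -- already has `x` as its prolongation.
      have hw : w = 0 := hw
      rw [hw, map_zero, eq_comm, sub_eq_zero] at hwz
      exact hwz.symm
    | succ m =>
      obtain ⟨y, hy⟩ := ih (m + 1) mem_ker
      -- Lifting the primitive of the projected cocycle to one jet order higher makes `x` minus its
      -- Spencer image a cocycle with zero projection.
      obtain ⟨y, rfl⟩ := map_holProj_surjective E hflat hδ (n + 1) m y
      obtain ⟨w, ⟨z, rfl⟩, hwz⟩ := lift (x - X.spencer E (n + 1) m y)
        (by rw [map_sub, hx, spencer_spencer, sub_zero])
        (by rw [map_sub, map_holProj_spencer, hy, sub_self])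
      refine ⟨y + BT.map (X.Form m) (X.symJet E (n + 2)) z, ?_⟩
      rw [map_add, spencer_map_symJet, hwz, add_sub_cancel]

end Acyclic

/-- Composing `jⁿ` with the successive projections recovers `j⁰ = id`. -/
theorem prolong_injective (n : ℕ) : Function.Injective (X.prolong E n) := by
  induction n with
  | zero => exact fun _ _ h => h
  | succ n ih =>
    intro e e' h
    apply ih
    rw [← holProj_prolong, h, holProj_prolong]

end ExtAlg

end NCJet

theorem corollary3p31 {k : Type v} {A : Type u} [CommRing k] [Ring A] [Algebra k A]
    (X : NCJet.ExtAlg k A) (hflat : X.IsFlat)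
    (hδ : ∀ (E : Type u) [AddCommGroup E] [Module A E] (n m : ℕ), (n, m) ≠ (0, 0) →
      Subsingleton (X.DeltaCohomology E n m)) :
    ∀ (E : Type u) [AddCommGroup E] [Module A E],
      (∀ n : ℕ, Function.Injective (X.prolong E n)) ∧
        ∀ n m : ℕ, Subsingleton (X.SpencerCohomology E n m) := by
  intro E _ _
  refine ⟨NCJet.ExtAlg.prolong_injective E, fun n m => ?_⟩
  rw [QuotientAddGroup.subsingleton_iff, AddSubgroup.addSubgroupOf_eq_top]
  exact NCJet.ExtAlg.spencerKer_le_spencerIm E hflat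
    (fun n m h => NCJet.ExtAlg.deltaKer_le_deltaIm E (hδ E n m h)) n m
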